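/- Let $k$ be an algebraically closed field of characteristic $0$. For $r\ge 1$ let $R=k[X_1,\dots,X_r]$ act on $\mathcal D=k[x_1,\dots,x_r]$ by differentiation ($X_i * f=\partial f/\partial x_i$), and for a subspace $\mathcal W\subseteq\mathcal D$ put $\mathrm{Ann}(\mathcal W)=\{F\in R: F*f=0\ \text{for all } f\in\mathcal W\}$. A graded Artinian quotient $A=R/I=\bigoplus_{0\le d\le j}A_d$ with $A_j\ne 0$ is *level of socle degree $j$* if $\{a\in A: aA_1=0\}=A_j$; it has *codimension $r$* if $I$ contains no nonzero form of degree $0$ or $1$; its Hilbert function is $h(d)=\dim_k A_d$. It is *unimodal* if for some $0\le i\le j$ the function $h$ is nondecreasing on $\{0,\dots,i\}$ and nonincreasing on $\{i,\dots,j\}$, and *non-unimodal* otherwise. We say $h$ has a *single drop with initial degree $i$* if $h(i)>h(i+1)<h(i+2)$ (final degree $i_f=i+2$), and a *double drop with initial degree $i$* if $h(i)>\max\{h(i+1),h(i+2)\}<h(i+3)$ (final degree $i_f=i+3$). For a tuple $K=(K_1,\dots,K_n)$ of non-negative integers, $n\le r$, let $\mathcal M_K(d)$ be the set of multi-indices $D\in\mathbb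 Z_{\ge0}^r$ of degree $d$ with $D_l\le K_l$ for $l\le n$, and $m_K(d)=\#\mathcal M_K(d)$. Given $r,j,P,Q,s,u$, a point $C\in k^{s\,m_P(j)}$ defines $\mathcal E(C)=\langle f_1,\dots,f_s\rangle\subseteq\mathcal D_j$, where $f_t=\sum_{J\in\mathcal M_P(j)}C_{tJ}x^J$; likewise $C'\in k^{u\,m_Q(j)}$ defines $\mathcal F(C')=\langle g_1,\dots,g_u\rangle$, where $g_t=\sum_{J\in\mathcal M_Q(j)}C'_{tJ}x^J$. Call $s$ *sufficient* if the matrix with rows indexed by $\mathcal M_P(j-i_f)\times\{1,\dots,s\}$ and columns indexed by $\mathcal M_P(i_f)$ has at least as many rows as columns, i.e. $s\,m_P(j-i_f)\ge m_P(i_f)$. Consider the following six families, with integer parameters, where $s$ is always required to be sufficient, $i_f=i+3$ for $F_1,G_1,H_1$, and $i_f=i+2$ for $F_2,G_2,G_3$: - $F_1(a,i,s)$: $r=3$, $j=i+a$, $P=(a-1)$, $Q=(j,j,j)$, $u=1$; $a\ge4$, $i\ge2a$. - $F_2(a,i,s)$: $r=3$, $j=i+\frac{a-1}2$, $P=(a-1)$,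 $Q=(j,j,j)$, $u=2$; $a\ge7$ odd, $i\ge\frac{2a-3+\sqrt{2a^2+8a+7}}2$. - $G_1(a,b,i,s)$: $r=4$, $j=i+ab$, $P=(a-1,b-1)$, $Q=(j,j,j,0)$, $u=1$; $b\ge a\ge2$, $i\ge ab+1$. - $G_2(a,b,i,s)$: $r=4$, $j=i+\frac{ab}2$, $P=(j,a-1,b-1)$, $Q=(1)$, $u=1$; $b\ge a\ge2$, $ab$ even, $i\ge\frac{ab}2+2$. - $G_3(a,b,i,s)$: $r=4$, $j=i+m$ with $m$ the largest integer such that $\binom{m+1}2<ab$, $P=(a-1,b-1)$, $Q=(j,j,j,j)$, $u=1$; $b\ge a\ge2$, $ab$ is not of the form $\binom N2$, $i\ge a+b-3$, $\frac{ab(2i-a-b+4)}2+\binom{m+3}3\le\binom{i+3}3$. - $H_1(a,b,c,i,s)$: $r=5$, $j=i+abc$, $P=(a-1,b-1,c-1)$, $Q=(j,j,j,0,0)$, $u=1$; $c\ge b\ge a\ge2$, $i\ge abc$. **Theorem.** For each of these families and every admissible choice of its parameters there are dense Zariski-open sets $U\subseteq k^{s\,m_P(j)}$ and $U'\subseteq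 k^{u\,m_Q(j)}$ such that for all $C\in U$ and $C'\in U'$: $\mathcal E(C)\cap\mathcal F(C')=0$; the algebra $A=R/\mathrm{Ann}(\mathcal E(C)\oplus\mathcal F(C'))$ is a level algebra of socle degree $j$ and codimension $r$; and $A$ is non-unimodal. Moreover its Hilbert function has a single drop with initial degree $i$ for the families $F_2,G_2,G_3$, and a double drop with initial degree $i$ for the families $F_1,G_1,H_1$. -/

import Mathlib

namespace LevelAlg

open MvPolynomial

/-! ### Polynomials as differential operators -/

section Action

variable {k : Type*} [Field k] {r : ℕ}

/-- The operator `∂/∂x_i` on `𝒟 = k[x_1, …, x_r]`, as a `k`-linear endomorphism. -/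
noncomputable def partialD (i : Fin r) : Module.End k (MvPolynomial (Fin r) k) :=
  (pderiv i : Derivation k (MvPolynomial (Fin r) k) (MvPolynomial (Fin r) k)).toLinearMap

theorem partialD_commute (i l : Fin r) :
    Commute (partialD (k := k) i) (partialD (k := k) l) := by
  have h : ⁅(pderiv i : Derivation k (MvPolynomial (Fin r) k) (MvPolynomial (Fin r) k)),
      (pderiv l : Derivation k (MvPolynomial (Fin r) k) (MvPolynomial (Fin r) k))⁆ = 0 := by
    apply MvPolynomial.derivation_ext
    intro m
    have hc : ∀ a b : Fin r, pderiv a (pderiv b (X m : MvPolynomial (Fin r) k)) = 0 := by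
      intro a b
      rw [pderiv_X, Pi.single_apply]
      split_ifs <;> simp
    rw [Derivation.commutator_apply, hc, hc, sub_zero, Derivation.zero_apply]
  refine LinearMap.ext fun f => ?_
  have := congrArg (fun D => D f) h
  simp only [Derivation.commutator_apply, Derivation.zero_apply] at this
  exact sub_eq_zero.mp this

theorem partialD_pow_pairwise (D : Fin r →₀ ℕ) :
    ((Finset.univ : Finset (Fin r)) : Set (Fin r)).Pairwise
      (Function.onFun Commute fun i => partialD (k := k) i ^ D i) :=
  fun i _ l _ _ => (partialD_commute i l).pow_pow _ _

/-- The iterated partial derivative `∂^D = ∏ i, (∂/∂x_i)^(D i)` attached to a multi-index `D`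
(the factors commute, so the order of composition is irrelevant). -/
noncomputable def iterPartialD (D : Fin r →₀ ℕ) : Module.End k (MvPolynomial (Fin r) k) :=
  Finset.univ.noncommProd (fun i => partialD i ^ D i) (partialD_pow_pairwise D)

theorem iterPartialD_zero : iterPartialD (k := k) (0 : Fin r →₀ ℕ) = 1 := by
  unfold iterPartialD
  rw [Finset.noncommProd_eq_pow_card _ _ _ 1 (fun i _ => by simp), one_pow]

theorem iterPartialD_add (D E : Fin r →₀ ℕ) :
    iterPartialD (k := k) (D + E) = iterPartialD D * iterPartialD E := by
  unfold iterPartialD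
  rw [← Finset.noncommProd_mul_distrib (fun i => partialD (k := k) i ^ D i)
    (fun i => partialD (k := k) i ^ E i)
    (fun i _ l _ _ => (partialD_commute i l).pow_pow _ _)
    (fun i _ l _ _ => (partialD_commute i l).pow_pow _ _)
    (fun i _ l _ _ => (partialD_commute i l).pow_pow _ _)]
  exact Finset.noncommProd_congr rfl (fun i _ => pow_add _ _ _) _

theorem iterPartialD_single (i : Fin r) :
    iterPartialD (k := k) (Finsupp.single i 1) = partialD i := by
  have hrest := Finset.noncommProd_eq_pow_card (Finset.univ.erase i)
    (fun l => partialD (k := k) l ^ (Finsupp.single i 1 : Fin r →₀ ℕ) l)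
    ((partialD_pow_pairwise _).mono (by simp)) 1
    (fun l hl => by rw [Finsupp.single_eq_of_ne (Finset.ne_of_mem_erase hl), pow_zero])
  have h := Finset.mul_noncommProd_erase Finset.univ (Finset.mem_univ i)
    (fun l => partialD (k := k) l ^ (Finsupp.single i 1 : Fin r →₀ ℕ) l)
    (partialD_pow_pairwise _)
  refine h.symm.trans ?_
  refine (congrArg _ hrest).trans ?_
  simp

/-- Multi-indexes act multiplicatively: `∂^0 = 1` and `∂^(D + E) = ∂^D ∘ ∂^E`. -/
noncomputable def iterPartialDHom :
    Multiplicative (Fin r →₀ ℕ) →* Module.End k (MvPolynomial (Fin r) k) where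
  toFun D := iterPartialD D.toAdd
  map_one' := iterPartialD_zero
  map_mul' D E := iterPartialD_add D.toAdd E.toAdd

/-- The action of `R = k[X_1, …, X_r]` on `𝒟 = k[x_1, …, x_r]` by differential operators:
`diffOp F f` is `F * f`, where `X^D` acts as `∂^D`.  Both rings are modelled by
`MvPolynomial (Fin r) k`. -/
noncomputable def diffOp :
    MvPolynomial (Fin r) k →ₐ[k] Module.End k (MvPolynomial (Fin r) k) :=
  AddMonoidAlgebra.lift k (Module.End k (MvPolynomial (Fin r) k)) (Fin r →₀ ℕ) iterPartialDHom

theorem diffOp_monomial (D : Fin r →₀ ℕ) (c : k) (f : MvPolynomial (Fin r) k) :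
    diffOp (monomial D c) f = c • iterPartialD D f := by
  have h : diffOp (monomial D c) =
      AddMonoidAlgebra.lift k (Module.End k (MvPolynomial (Fin r) k)) (Fin r →₀ ℕ)
        iterPartialDHom (AddMonoidAlgebra.single D c) := rfl
  rw [h, AddMonoidAlgebra.lift_single]
  rfl

theorem diffOp_X (i : Fin r) (f : MvPolynomial (Fin r) k) :
    diffOp (X i) f = pderiv i f := by
  rw [X, diffOp_monomial, one_smul, iterPartialD_single]
  rfl

/-- `Ann_R(𝒲) = {F ∈ R | F * f = 0 for all f ∈ 𝒲}`. -/
noncomputable def annIdeal (W : Submodule k (MvPolynomial (Fin r) k)) :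
    Ideal (MvPolynomial (Fin r) k) where
  carrier := {F | ∀ f ∈ W, diffOp F f = 0}
  zero_mem' := by
    intro f _
    simp
  add_mem' := by
    intro F G hF hG f hf
    simp [hF f hf, hG f hf]
  smul_mem' := by
    intro G F hF f hf
    simp [hF f hf]

end Action

/-! ### Graded quotients, level algebras, Hilbert functions -/

section Graded

variable {k : Type*} [Field k] {r : ℕ}

/-- The degree `d` piece `A_d` of `A = R/I`: the image of the forms of degree `d`. -/
noncomputable def gradedPiece (I : Ideal (MvPolynomial (Fin r) k)) (d : ℕ) :
    Submodule k (MvPolynomial (Fin r) k ⧸ I) :=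
  (homogeneousSubmodule (Fin r) k d).map (Ideal.Quotient.mkₐ k I).toLinearMap

/-- The Hilbert function `h_A(d) = dim_k A_d` of `A = R/I`. -/
noncomputable def hilbertFn (I : Ideal (MvPolynomial (Fin r) k)) (d : ℕ) : ℕ :=
  Module.finrank k (gradedPiece I d)

/-- The socle `{a ∈ A | a A_1 = 0}` of `A = R/I`. -/
def socle (I : Ideal (MvPolynomial (Fin r) k)) : Set (MvPolynomial (Fin r) k ⧸ I) :=
  {a | ∀ l ∈ gradedPiece I 1, a * l = 0}

/-- `A = R/I` is a graded Artinian level algebra of socle degree `j`: `I` is homogeneous, `A` is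
finite-dimensional, `j` is the largest degree with `A_j ≠ 0`, and `soc(A) = A_j`. -/
structure IsLevel (I : Ideal (MvPolynomial (Fin r) k)) (j : ℕ) : Prop where
  homogeneous : ∀ F ∈ I, ∀ d : ℕ, homogeneousComponent d F ∈ I
  artinian : Module.Finite k (MvPolynomial (Fin r) k ⧸ I)
  top_ne_bot : gradedPiece I j ≠ ⊥
  eq_bot_of_lt : ∀ d, j < d → gradedPiece I d = ⊥
  socle_eq : socle I = (gradedPiece I j : Set (MvPolynomial (Fin r) k ⧸ I))

/-- `R/I` has codimension `r`, the number of variables of `R`: `I_0 = 0` and `I_1 = 0`. -/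
def HasFullCodim (I : Ideal (MvPolynomial (Fin r) k)) : Prop :=
  ∀ F ∈ I, F.IsHomogeneous 0 ∨ F.IsHomogeneous 1 → F = 0

end Graded

/-- A Hilbert function `h`, considered in degrees `0, …, j`, is unimodal. -/
def IsUnimodal (h : ℕ → ℕ) (j : ℕ) : Prop :=
  ∃ i ≤ j, MonotoneOn h (Set.Icc 0 i) ∧ AntitoneOn h (Set.Icc i j)

/-- A single drop with initial degree `i` (and final degree `i + 2`). -/
def HasSingleDrop (h : ℕ → ℕ) (i : ℕ) : Prop :=
  h (i + 1) < h i ∧ h (i + 1) < h (i + 2)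

/-- A double drop with initial degree `i` (and final degree `i + 3`). -/
def HasDoubleDrop (h : ℕ → ℕ) (i : ℕ) : Prop :=
  max (h (i + 1)) (h (i + 2)) < h i ∧ max (h (i + 1)) (h (i + 2)) < h (i + 3)

/-! ### The Zariski topology on an affine space and general points -/

section General

variable {k : Type*} [Field k] {σ : Type*}

/-- Zariski-open subsets of the affine space `k^σ`: complements of common zero sets. -/
def IsZariskiOpen (U : Set (σ → k)) : Prop :=
  ∃ S : Set (MvPolynomial σ k), U = {c | ∀ p ∈ S, eval c p = 0}ᶜ

/-- Zariski-dense subsets: those meeting every nonempty Zariski-open subset. -/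
def IsZariskiDense (U : Set (σ → k)) : Prop :=
  ∀ V : Set (σ → k), IsZariskiOpen V → V.Nonempty → (U ∩ V).Nonempty

end General

/-! ### Constrained monomials and the families of subspaces they generate -/

/-- The multi-indexes of dimension `r` and degree `d` that are constrained by
`K = (K_1, …, K_n)`, i.e. whose `i`-th entry is at most `K_i` for `i = 1, …, n`. -/
def constrainedIdx (r : ℕ) (K : List ℕ) (d : ℕ) : Finset (Fin r →₀ ℕ) :=
  (Finset.finsuppAntidiag Finset.univ d).filter
    fun D => ∀ i : Fin r, ∀ h : (i : ℕ) < K.length, D i ≤ K[(i : ℕ)]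

/-- Coefficients for `n` polynomials in the span of the monomials of degree `j` constrained by
`K`: a point of the affine space `k^(n · m_K(j))`. -/
abbrev Coeffs (k : Type*) (r j : ℕ) (K : List ℕ) (n : ℕ) : Type _ :=
  Fin n × {J // J ∈ constrainedIdx r K j} → k

/-- The subspace `⟨f_1, …, f_n⟩ ⊆ 𝒟_j` with `f_t = ∑_J C_{tJ} x^J`, the sum being over the
multi-indexes `J` of degree `j` constrained by `K`. -/
noncomputable def spanFamily {k : Type*} [Field k] {r j : ℕ} {K : List ℕ} {n : ℕ}
    (C : Coeffs k r j K n) : Submodule k (MvPolynomial (Fin r) k) :=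
  Submodule.span k (Set.range fun t : Fin n =>
    ∑ J : {J // J ∈ constrainedIdx r K j}, monomial J.1 (C (t, J)))

/-- The discrete data of a family: number of variables `r`, socle degree `j`, constraints `P`, `Q`,
the numbers `s`, `u` of generators of `ℰ`, `ℱ`, and the final degree `iF` of the expected drop. -/
structure FamilyData where
  r : ℕ
  j : ℕ
  P : List ℕ
  Q : List ℕ
  s : ℕ
  u : ℕ
  iF : ℕ

namespace FamilyData

/-- Row indices of the `e`-th cropped matrix of `ℰ`: pairs `(E, t)` with `E` of degree `e`
constrained by `P` and `1 ≤ t ≤ s`. -/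
abbrev CroppedRows (Φ : FamilyData) (e : ℕ) : Type :=
  {E // E ∈ constrainedIdx Φ.r Φ.P e} × Fin Φ.s

/-- Column indices of the `e`-th cropped matrix of `ℰ`: multi-indexes of degree `d = j - e`
constrained by `P`. -/
abbrev CroppedCols (Φ : FamilyData) (e : ℕ) : Type :=
  {D // D ∈ constrainedIdx Φ.r Φ.P (Φ.j - e)}

/-- `s` is `h_ℰ`-sufficient: the `(j - iF)`-th cropped matrix of `ℰ` has at least as many rows as
columns. -/
def Sufficient (Φ : FamilyData) : Prop :=
  Fintype.card (Φ.CroppedCols (Φ.j - Φ.iF)) ≤ Fintype.card (Φ.CroppedRows (Φ.j - Φ.iF))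

/-- For general `C` and `C'`, the sum `ℰ(C) + ℱ(C')` is direct, `A = R/Ann(ℰ(C) ⊕ ℱ(C'))` is a
level algebra of socle degree `j` and codimension `r`, it is non-unimodal, and its Hilbert function
has the property `drop`. -/
def GenerallyNonUnimodal (Φ : FamilyData) (k : Type*) [Field k] (drop : (ℕ → ℕ) → Prop) : Prop :=
  ∃ (U : Set (Coeffs k Φ.r Φ.j Φ.P Φ.s)) (U' : Set (Coeffs k Φ.r Φ.j Φ.Q Φ.u)),
    IsZariskiOpen U ∧ IsZariskiDense U ∧ IsZariskiOpen U' ∧ IsZariskiDense U' ∧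
    ∀ C ∈ U, ∀ C' ∈ U',
      Disjoint (spanFamily C) (spanFamily C') ∧
      IsLevel (annIdeal (spanFamily C ⊔ spanFamily C')) Φ.j ∧
      HasFullCodim (annIdeal (spanFamily C ⊔ spanFamily C')) ∧
      ¬ IsUnimodal (hilbertFn (annIdeal (spanFamily C ⊔ spanFamily C'))) Φ.j ∧
      drop (hilbertFn (annIdeal (spanFamily C ⊔ spanFamily C')))

end FamilyData

/-! ### The six families -/

/-- `F_1(a,i,s)`. -/
def famF1 (a i s : ℕ) : FamilyData where
  r := 3
  j := i + a
  P := [a - 1]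
  Q := [i + a, i + a, i + a]
  s := s
  u := 1
  iF := i + 3

/-- `F_2(a,i,s)`, for odd `a`. -/
def famF2 (a i s : ℕ) : FamilyData where
  r := 3
  j := i + (a - 1) / 2
  P := [a - 1]
  Q := [i + (a - 1) / 2, i + (a - 1) / 2, i + (a - 1) / 2]
  s := s
  u := 2
  iF := i + 2

/-- `G_1(a,b,i,s)`. -/
def famG1 (a b i s : ℕ) : FamilyData where
  r := 4
  j := i + a * b
  P := [a - 1, b - 1]
  Q := [i + a * b, i + a * b, i + a * b, 0]
  s := s
  u := 1
  iF := i + 3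

/-- `G_2(a,b,i,s)`, for even `ab`. -/
def famG2 (a b i s : ℕ) : FamilyData where
  r := 4
  j := i + a * b / 2
  P := [i + a * b / 2, a - 1, b - 1]
  Q := [1]
  s := s
  u := 1
  iF := i + 2

/-- `G_3(a,b,i,s)`, where `m` is the largest integer with `binom(m+1,2) < ab`. -/
def famG3 (a b m i s : ℕ) : FamilyData where
  r := 4
  j := i + m
  P := [a - 1, b - 1]
  Q := [i + m, i + m, i + m, i + m]
  s := s
  u := 1
  iF := i + 2

/-- `H_1(a,b,c,i,s)`. -/
def famH1 (a b c i s : ℕ) : FamilyData where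
  r := 5
  j := i + a * b * c
  P := [a - 1, b - 1, c - 1]
  Q := [i + a * b * c, i + a * b * c, i + a * b * c, 0, 0]
  s := s
  u := 1
  iF := i + 3

end LevelAlg

/-! Write `m_P(d)` and `m_Q(d)` for the numbers of bounded monomials. A form of degree `d` kills `ℰ`
if its coefficients at `P`-bounded monomials vanish, and kills `ℱ` if `u · m_Q(j-d)` linear
conditions hold. Hence `h(d) ≤ m_P(d) + u · m_Q(j-d)` for all coefficients (`hilbertFn_le`).
Equality holds (`le_hilbertFn`) when no nonzero `P`-bounded form of degree `d` kills `ℰ`, and the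
catalecticant of `ℱ` already has full rank on the `Q`-bounded monomials that are not `P`-bounded.
The first condition passes to lower degrees and the second to higher ones, so it suffices to have
the first in degree `iF` and the second in degree `i`: the bound is then attained at `i` and `iF`,
and being an upper bound is all that is needed in between. From degree `i` on `m_P` grows by a
constant `N`, while `u · m_Q(j-d)` falls by steps that pass from above `N` to below `N`; this is the
drop.

The substance is that the catalecticants have maximal rank for general coefficients, although
entries whose monomial violates the bounds are zero. Monomials are graded by their exponents at the
bounded positions, and the pieces shrink as this class grows. `exists_nondegenerate` constructs a
nondegenerate pairing by induction: evaluation at a general point, placed on a maximal class sum,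
has rank one on each block it meets and removes one dimension from equally many pieces on either
side; the induction hypothesis handles the rest, and `exists_add_smul_injective` glues the two. A
determinant turns the single witness into a dense open set. Levelness is formal apolarity in
characteristic zero. -/

namespace LevelAlg

open MvPolynomial

/-! ### Perturbation of a linear map to an injective one. -/

section LinearAlgebra

variable {k : Type*} [Field k]

/-- If the second of two linear maps is injective from the kernel of the first to its cokernel,
then some combination of the two maps is injective. -/
theorem exists_add_smul_injective [Infinite k] {W Z : Type*} [AddCommGroup W] [Module k W]
    [FiniteDimensional k W] [AddCommGroup Z] [Module k Z] (X Y : W →ₗ[k] Z)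
    (h : ∀ w, X w = 0 → Y w ∈ LinearMap.range X → w = 0) :
    ∃ τ : k, ∀ w, X w + τ • Y w = 0 → w = 0 := by
  obtain ⟨V, hV⟩ := Submodule.exists_isCompl (LinearMap.ker X)
  set π : W →ₗ[k] LinearMap.ker X := (LinearMap.ker X).projectionOnto V hV with hπ
  set π' : W →ₗ[k] V := V.projectionOnto (LinearMap.ker X) hV.symm with hπ'
  have hsum : ∀ w, (π w : W) + π' w = w := fun w =>
    Submodule.projection_add_projection_eq_self hV w
  have hXπ : ∀ w, X (π w) = 0 := fun w => (π w).2
  -- `φ τ w = Y (π w) + (X + τ Y) (π' w)`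
  let φ₀ : W →ₗ[k] Z := Y ∘ₗ (Submodule.subtype _) ∘ₗ π + X
  let ψ : W →ₗ[k] Z := Y ∘ₗ (Submodule.subtype _) ∘ₗ π'
  have hφ₀ : LinearMap.ker φ₀ = ⊥ := by
    rw [LinearMap.ker_eq_bot']
    intro w hw
    have hw' : Y (π w) + X w = 0 := hw
    have h1 : (π w : W) = 0 := by
      refine h _ (hXπ w) ⟨-w, ?_⟩
      rw [map_neg]
      exact (eq_neg_of_add_eq_zero_left hw').symm
    rw [h1, map_zero, zero_add] at hw'
    refine h w hw' ?_
    have h2 : π w = w := by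
      exact congrArg Subtype.val (Submodule.projectionOnto_apply_left hV ⟨w, hw'⟩)
    rw [← h2, h1, map_zero]
    exact zero_mem _
  obtain ⟨ρ, hρ⟩ := LinearMap.exists_leftInverse_of_injective φ₀ hφ₀
  -- `φ₀` is injective, so `φ₀ - μ⁻¹ ψ` fails to be injective only if `μ` is an eigenvalue of `ρ ∘
  -- ψ`; these are finitely many and `k` is infinite.
  obtain ⟨μ, hμ⟩ := ((Module.End.finite_hasEigenvalue (ρ ∘ₗ ψ)).insert 0).exists_notMem
  rw [Set.mem_insert_iff, not_or] at hμ
  obtain ⟨hμ0, hμ⟩ := hμ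
  refine ⟨-μ⁻¹, fun w hw => ?_⟩
  have hinj : ∀ v, φ₀ v + (-μ⁻¹) • ψ v = 0 → v = 0 := by
    intro v hv
    by_contra hv0
    apply hμ
    refine Module.End.hasEigenvalue_of_hasEigenvector (x := v) ⟨?_, hv0⟩
    rw [Module.End.mem_eigenspace_iff]
    have h3 := congrArg ρ hv
    have h4 : ρ (φ₀ v) = v := LinearMap.congr_fun hρ v
    rw [map_add, map_smul, map_zero, h4] at h3
    have h5 : v = μ⁻¹ • ρ (ψ v) := by
      rw [neg_smul] at h3
      exact sub_eq_zero.mp (by rwa [sub_eq_add_neg])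
    conv_rhs => rw [h5]
    rw [smul_smul, mul_inv_cancel₀ hμ0, one_smul]
    rfl
  have hππ : ∀ w, π (π w) = π w := fun w => Submodule.projectionOnto_apply_left hV _
  have hππ' : ∀ w, π (π' w) = 0 := fun w =>
    (Submodule.projectionOnto_apply_eq_zero_iff hV).2 (π' w).2
  have hπ'π' : ∀ w, π' (π' w) = π' w := fun w => Submodule.projectionOnto_apply_left hV.symm _
  have hπ'π : ∀ w, π' (π w) = 0 := fun w =>
    (Submodule.projectionOnto_apply_eq_zero_iff hV.symm).2 (π w).2
  -- Scaling the `ker X` component by `τ = -μ⁻¹` converts `φ₀ + τ ψ` into `X + τ Y`: the image of `τ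
  -- π w + π' w` under the former is `X w + τ Y w`.
  have hv := hinj ((-μ⁻¹) • (π w : W) + π' w) (by
    have e1 : φ₀ ((-μ⁻¹) • (π w : W) + π' w) = (-μ⁻¹) • Y (π w) + X (π' w) := by
      simp only [φ₀, LinearMap.add_apply, LinearMap.comp_apply, map_add, map_smul, hππ, hππ',
        Submodule.subtype_apply, hXπ, map_zero, add_zero, zero_add]
    have e2 : ψ ((-μ⁻¹) • (π w : W) + π' w) = Y (π' w) := by
      simp only [ψ, LinearMap.comp_apply, map_add, map_smul, hπ'π, hπ'π',
        Submodule.subtype_apply, map_zero, smul_zero, zero_add]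
    rw [e1, e2]
    have e3 : X w = X (π' w) := by
      conv_lhs => rw [← hsum w, map_add, hXπ, zero_add]
    have e4 : Y w = Y (π w) + Y (π' w) := by
      conv_lhs => rw [← hsum w, map_add]
    rw [e3, e4, smul_add] at hw
    rw [← hw]
    abel)
  have h6 := congrArg π hv
  rw [map_add, map_smul, hππ, hππ', add_zero, map_zero] at h6
  have h7 : π w = 0 := (smul_eq_zero.mp h6).resolve_left (neg_ne_zero.2 (inv_ne_zero hμ0))
  rw [h7] at hv
  rw [← hsum w, h7]
  simpa using hv

theorem finrank_inf_ker_add_one {M : Type*} [AddCommGroup M] [Module k M] (L : Submodule k M)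
    [FiniteDimensional k L] (φ : M →ₗ[k] k) {g : M} (hg : g ∈ L) (hφ : φ g ≠ 0) :
    Module.finrank k (L ⊓ LinearMap.ker φ : Submodule k M) + 1 = Module.finrank k L := by
  have h1 := (φ ∘ₗ L.subtype).finrank_range_add_finrank_ker
  have h2 : LinearMap.range (φ ∘ₗ L.subtype) = ⊤ := by
    refine LinearMap.range_eq_top.2 (LinearMap.surjective ?_)
    intro h0
    exact hφ (LinearMap.congr_fun h0 ⟨g, hg⟩)
  have h3 : Module.finrank k (LinearMap.ker (φ ∘ₗ L.subtype)) =
      Module.finrank k (L ⊓ LinearMap.ker φ : Submodule k M) := by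
    rw [LinearMap.ker_comp, ← Submodule.map_comap_subtype,
      ← (Submodule.equivMapOfInjective L.subtype L.injective_subtype _).finrank_eq]
  rw [h2, finrank_top, Module.finrank_self, h3] at h1
  omega

end LinearAlgebra

/-! ### Generic nondegeneracy of pairings graded by a box. -/

section Pairing

variable {k : Type*} [Field k] {τ ι : Type*}

theorem exists_eval_ne_zero [Infinite k] (A : Finset ι) (q : ι → MvPolynomial τ k)
    (h : ∀ a ∈ A, q a ≠ 0) : ∃ pt : τ → k, ∀ a ∈ A, eval pt (q a) ≠ 0 := by
  have h1 : ∏ a ∈ A, q a ≠ 0 := Finset.prod_ne_zero_iff.2 h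
  by_contra! hcon
  apply h1
  refine MvPolynomial.funext fun pt => ?_
  obtain ⟨a, ha, ha0⟩ := hcon pt
  rw [map_prod, map_zero]
  exact Finset.prod_eq_zero ha ha0

/-- If one element is removed from the pieces `L α`, `α + β = γ`, where `γ` is maximal among the
sums of indices of nonzero pieces, then the dimensions still decrease with the index. -/
theorem finrank_antitone_of_removal {M : Type*} [AddCommGroup M] [Module k M]
    {L K L' : (ι → ℕ) → Submodule k M} {p γ : ι → ℕ}
    [∀ α, FiniteDimensional k (L α)] [∀ α, FiniteDimensional k (K α)]
    (hL : ∀ α β, α ≤ β → β ≤ p → Module.finrank k (L β) ≤ Module.finrank k (L α))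
    (hK : ∀ α β, α ≤ β → β ≤ p → Module.finrank k (K β) ≤ Module.finrank k (K α))
    (hγ : γ ≤ p)
    (hmax : ∀ α β, α + β ≤ p → γ ≤ α + β → L α ≠ ⊥ → K β ≠ ⊥ → α + β ≤ γ)
    (hin : ∀ α, α ≤ γ → L α ≠ ⊥ → K (γ - α) ≠ ⊥ →
      Module.finrank k (L' α) + 1 = Module.finrank k (L α))
    (hout : ∀ α, ¬ (α ≤ γ ∧ L α ≠ ⊥ ∧ K (γ - α) ≠ ⊥) → L' α = L α) :
    ∀ α β, α ≤ β → β ≤ p → Module.finrank k (L' β) ≤ Module.finrank k (L' α) := by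
  intro α β hαβ hβ
  have h1 := hL α β hαβ hβ
  by_cases hβm : β ≤ γ ∧ L β ≠ ⊥ ∧ K (γ - β) ≠ ⊥
  · have h2 := hin β hβm.1 hβm.2.1 hβm.2.2
    by_cases hαm : α ≤ γ ∧ L α ≠ ⊥ ∧ K (γ - α) ≠ ⊥
    · have h3 := hin α hαm.1 hαm.2.1 hαm.2.2
      omega
    · rw [hout α hαm]
      omega
  · rw [hout β hβm]
    by_cases hαm : α ≤ γ ∧ L α ≠ ⊥ ∧ K (γ - α) ≠ ⊥
    · have h3 := hin α hαm.1 hαm.2.1 hαm.2.2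
      by_cases hLβ : L β = ⊥
      · rw [hLβ, finrank_bot]
        exact Nat.zero_le _
      -- The dangerous case: `L α` loses a dimension and `L β` does not. Monotonicity of `K` makes
      -- `K (γ - β)` nonzero, and maximality of `γ` applied to `β + (γ - β)`, which is at least `γ`
      -- even with truncated subtraction, forces `β ≤ γ`; so `L β` loses a dimension after all.
      have hKβ : K (γ - β) ≠ ⊥ := by
        have h4 := hK (γ - β) (γ - α) (tsub_le_tsub_left hαβ γ) (tsub_le_self.trans hγ)
        have h5 : Module.finrank k (K (γ - α)) ≠ 0 := fun h =>
          hαm.2.2 (Submodule.finrank_eq_zero.1 h)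
        intro h
        rw [h, finrank_bot] at h4
        omega
      have h6 : β + (γ - β) ≤ p := by
        intro i
        have h1 : β i ≤ p i := hβ i
        have h2 : γ i ≤ p i := hγ i
        show β i + (γ i - β i) ≤ p i
        omega
      have h7 := hmax β (γ - β) h6 le_add_tsub hLβ hKβ
      exact absurd ⟨le_self_add.trans h7, hLβ, hKβ⟩ hβm
    · rw [hout α hαm]
      exact h1

open scoped Classical in
/-- **Generic nondegeneracy.**  Let `L α` and `K β` be finite-dimensional spaces of polynomials
indexed by the points of a box, with dimensions decreasing in the index.  If the `L α` have
together at least the dimension of the `K β`, then there are functionals `F γ` for which the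
pairing `∑_{α + β ≤ p} F (α + β) (g_α h_β)` is nondegenerate on the side of the `K β`. -/
theorem exists_nondegenerate [Fintype ι] [Infinite k] (p : ι → ℕ) (n : ℕ) :
    ∀ (L K : (ι → ℕ) → Submodule k (MvPolynomial τ k))
      [∀ α, FiniteDimensional k (L α)] [∀ α, FiniteDimensional k (K α)],
    (∀ α β, α ≤ β → β ≤ p → Module.finrank k (L β) ≤ Module.finrank k (L α)) →
    (∀ α β, α ≤ β → β ≤ p → Module.finrank k (K β) ≤ Module.finrank k (K α)) →
    ∑ β ∈ Finset.Iic p, Module.finrank k (K β) = n →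
    ∑ β ∈ Finset.Iic p, Module.finrank k (K β) ≤ ∑ α ∈ Finset.Iic p, Module.finrank k (L α) →
    ∃ F : (ι → ℕ) → (MvPolynomial τ k →ₗ[k] k), ∀ h : (ι → ℕ) → MvPolynomial τ k,
      (∀ β ≤ p, h β ∈ K β) →
      (∀ α ≤ p, ∀ g ∈ L α,
        ∑ β ∈ Finset.Iic p, (if α + β ≤ p then F (α + β) (g * h β) else 0) = 0) →
      ∀ β ≤ p, h β = 0 := by
  induction n using Nat.strong_induction_on with
  | _ n ih =>
  intro L K _ _ hL hK hn hle
  by_cases hbot : ∀ β ≤ p, K β = ⊥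
  · refine ⟨0, fun h hh _ β hβ => ?_⟩
    have := hh β hβ
    rwa [hbot β hβ, Submodule.mem_bot] at this
  push Not at hbot
  obtain ⟨β₀, hβ₀, hKβ₀⟩ := hbot
  have hpos : 0 < n := by
    rw [← hn]
    refine Finset.sum_pos' (fun _ _ => Nat.zero_le _) ⟨β₀, Finset.mem_Iic.2 hβ₀, ?_⟩
    exact Nat.pos_of_ne_zero fun h => hKβ₀ (Submodule.finrank_eq_zero.1 h)
  have hK0 : K 0 ≠ ⊥ := by
    intro h
    have := hK 0 β₀ zero_le hβ₀
    rw [h, finrank_bot] at this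
    exact hKβ₀ (Submodule.finrank_eq_zero.1 (by omega))
  have hL0 : L 0 ≠ ⊥ := by
    intro h
    have h1 : ∑ α ∈ Finset.Iic p, Module.finrank k (L α) = 0 := by
      refine Finset.sum_eq_zero fun α hα => ?_
      have := hL 0 α zero_le (Finset.mem_Iic.1 hα)
      rw [h, finrank_bot] at this
      omega
    omega
  -- a maximal sum `γ` of indices of nonzero pieces
  let S : Finset (ι → ℕ) := (Finset.Iic p).filter fun γ =>
    ∃ α β, α + β = γ ∧ L α ≠ ⊥ ∧ K β ≠ ⊥
  obtain ⟨γ, hγS, hγmax⟩ := S.exists_maximal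
    ⟨0, Finset.mem_filter.2 ⟨Finset.mem_Iic.2 zero_le, 0, 0, add_zero _, hL0, hK0⟩⟩
  obtain ⟨hγp, α₁, β₁, hαβ₁, hLα₁, hKβ₁⟩ := Finset.mem_filter.1 hγS
  rw [Finset.mem_Iic] at hγp
  have hmax : ∀ α β, α + β ≤ p → γ ≤ α + β → L α ≠ ⊥ → K β ≠ ⊥ → α + β ≤ γ :=
    fun α β h1 h2 h3 h4 =>
      hγmax (Finset.mem_filter.2 ⟨Finset.mem_Iic.2 h1, α, β, rfl, h3, h4⟩) h2
  -- a point where suitable elements of all nonzero pieces do not vanish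
  have hgL : ∀ α, ∃ g ∈ L α, L α ≠ ⊥ → g ≠ 0 := by
    intro α
    by_cases h : L α = ⊥
    · exact ⟨0, zero_mem _, fun h' => absurd h h'⟩
    · obtain ⟨g, hg, hg0⟩ := Submodule.exists_mem_ne_zero_of_ne_bot h
      exact ⟨g, hg, fun _ => hg0⟩
  have hgK : ∀ α, ∃ g ∈ K α, K α ≠ ⊥ → g ≠ 0 := by
    intro α
    by_cases h : K α = ⊥
    · exact ⟨0, zero_mem _, fun h' => absurd h h'⟩
    · obtain ⟨g, hg, hg0⟩ := Submodule.exists_mem_ne_zero_of_ne_bot h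
      exact ⟨g, hg, fun _ => hg0⟩
  choose gL hgL hgL0 using hgL
  choose gK hgK hgK0 using hgK
  -- The Boolean index treats the two products together, so that a single point serves both sides of
  -- the pairing.
  obtain ⟨pt, hpt⟩ := exists_eval_ne_zero (k := k) (Finset.univ : Finset Bool)
    (fun b => if b then ∏ α ∈ (Finset.Iic p).filter (fun α => L α ≠ ⊥), gL α
      else ∏ α ∈ (Finset.Iic p).filter (fun α => K α ≠ ⊥), gK α) (by
    intro b _
    cases b
    · simp only [Bool.false_eq_true, if_false]
      exact Finset.prod_ne_zero_iff.2 fun α hα => hgK0 α (Finset.mem_filter.1 hα).2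
    · simp only [if_true]
      exact Finset.prod_ne_zero_iff.2 fun α hα => hgL0 α (Finset.mem_filter.1 hα).2)
  let ev : MvPolynomial τ k →ₗ[k] k := (aeval pt : MvPolynomial τ k →ₐ[k] k).toLinearMap
  have hev : ∀ f, ev f = eval pt f := fun f => by
    simp [ev, aeval_eq_eval]
  have hevmul : ∀ f g, ev (f * g) = ev f * ev g := fun f g => by
    rw [hev, hev, hev, map_mul]
  have hevL : ∀ α ≤ p, L α ≠ ⊥ → ev (gL α) ≠ 0 := by
    intro α hα h
    have h1 := hpt true (Finset.mem_univ _)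
    simp only [if_true, map_prod] at h1
    rw [hev]
    exact Finset.prod_ne_zero_iff.1 h1 α (Finset.mem_filter.2 ⟨Finset.mem_Iic.2 hα, h⟩)
  have hevK : ∀ α ≤ p, K α ≠ ⊥ → ev (gK α) ≠ 0 := by
    intro α hα h
    have h1 := hpt false (Finset.mem_univ _)
    simp only [Bool.false_eq_true, if_false, map_prod] at h1
    rw [hev]
    exact Finset.prod_ne_zero_iff.1 h1 α (Finset.mem_filter.2 ⟨Finset.mem_Iic.2 hα, h⟩)
  -- the reduced pieces
  let actL : (ι → ℕ) → Prop := fun α => α ≤ γ ∧ L α ≠ ⊥ ∧ K (γ - α) ≠ ⊥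
  let actK : (ι → ℕ) → Prop := fun β => β ≤ γ ∧ K β ≠ ⊥ ∧ L (γ - β) ≠ ⊥
  let L' : (ι → ℕ) → Submodule k (MvPolynomial τ k) := fun α =>
    if actL α then L α ⊓ LinearMap.ker ev else L α
  let K' : (ι → ℕ) → Submodule k (MvPolynomial τ k) := fun β =>
    if actK β then K β ⊓ LinearMap.ker ev else K β
  have hL'le : ∀ α, L' α ≤ L α := by
    intro α
    simp only [L']
    split_ifs
    · exact inf_le_left
    · exact le_rfl
  have hK'le : ∀ α, K' α ≤ K α := by
    intro α
    simp only [K']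
    split_ifs
    · exact inf_le_left
    · exact le_rfl
  have : ∀ α, FiniteDimensional k (L' α) := fun α =>
    Submodule.finiteDimensional_of_le (hL'le α)
  have : ∀ α, FiniteDimensional k (K' α) := fun α =>
    Submodule.finiteDimensional_of_le (hK'le α)
  have hinL : ∀ α, actL α → Module.finrank k (L' α) + 1 = Module.finrank k (L α) := by
    intro α hα
    rw [show L' α = L α ⊓ LinearMap.ker ev from if_pos hα]
    exact finrank_inf_ker_add_one _ _ (hgL α) (hevL α (hα.1.trans hγp) hα.2.1)
  have hinK : ∀ α, actK α → Module.finrank k (K' α) + 1 = Module.finrank k (K α) := by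
    intro α hα
    rw [show K' α = K α ⊓ LinearMap.ker ev from if_pos hα]
    exact finrank_inf_ker_add_one _ _ (hgK α) (hevK α (hα.1.trans hγp) hα.2.1)
  have houtL : ∀ α, ¬ actL α → L' α = L α := fun α hα => by simp only [L', if_neg hα]
  have houtK : ∀ α, ¬ actK α → K' α = K α := fun α hα => by simp only [K', if_neg hα]
  have hantiL := finrank_antitone_of_removal (L' := L') hL hK hγp hmax
    (fun α h1 h2 h3 => hinL α ⟨h1, h2, h3⟩) houtL
  have hantiK := finrank_antitone_of_removal (L' := K') hK hL hγp
    (fun α β h1 h2 h3 h4 => by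
      rw [add_comm] at h1 h2 ⊢
      exact hmax β α h1 h2 h4 h3)
    (fun α h1 h2 h3 => hinK α ⟨h1, h2, h3⟩) houtK
  have hsumL : ∑ α ∈ Finset.Iic p, Module.finrank k (L' α) +
      ((Finset.Iic p).filter actL).card = ∑ α ∈ Finset.Iic p, Module.finrank k (L α) := by
    rw [Finset.card_filter, ← Finset.sum_add_distrib]
    refine Finset.sum_congr rfl fun α _ => ?_
    split_ifs with h
    · exact hinL α h
    · rw [houtL α h, add_zero]
  have hsumK : ∑ α ∈ Finset.Iic p, Module.finrank k (K' α) +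
      ((Finset.Iic p).filter actK).card = ∑ α ∈ Finset.Iic p, Module.finrank k (K α) := by
    rw [Finset.card_filter, ← Finset.sum_add_distrib]
    refine Finset.sum_congr rfl fun α _ => ?_
    split_ifs with h
    · exact hinK α h
    · rw [houtK α h, add_zero]
  -- Reflection `α ↦ γ - α` exchanges the active indices of the two sides, so both total dimensions
  -- drop by the same amount and the inequality between them survives.
  have hcard : ((Finset.Iic p).filter actL).card = ((Finset.Iic p).filter actK).card := by
    refine Finset.card_bij' (fun α _ => γ - α) (fun β _ => γ - β) ?_ ?_ ?_ ?_
    · intro α hα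
      obtain ⟨_, h1, h2, h3⟩ := Finset.mem_filter.1 hα
      refine Finset.mem_filter.2 ⟨Finset.mem_Iic.2 (tsub_le_self.trans hγp), tsub_le_self, h3, ?_⟩
      rwa [tsub_tsub_cancel_of_le h1]
    · intro α hα
      obtain ⟨_, h1, h2, h3⟩ := Finset.mem_filter.1 hα
      refine Finset.mem_filter.2 ⟨Finset.mem_Iic.2 (tsub_le_self.trans hγp), tsub_le_self, h3, ?_⟩
      rwa [tsub_tsub_cancel_of_le h1]
    · intro α hα
      exact tsub_tsub_cancel_of_le (Finset.mem_filter.1 hα).2.1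
    · intro α hα
      exact tsub_tsub_cancel_of_le (Finset.mem_filter.1 hα).2.1
  have hcardpos : 0 < ((Finset.Iic p).filter actK).card := by
    refine Finset.card_pos.2 ⟨β₁, Finset.mem_filter.2 ⟨?_, ?_, hKβ₁, ?_⟩⟩
    · rw [Finset.mem_Iic]
      exact (le_add_self.trans hαβ₁.le).trans hγp
    · rw [← hαβ₁]
      exact le_add_self
    · rw [← hαβ₁, add_tsub_cancel_right]
      exact hLα₁
  obtain ⟨F', hF'⟩ := ih _ (by omega) L' K' hantiL hantiK rfl (by omega)
  -- combine `F'` with the evaluation at `pt`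
  let E : (ι → ℕ) → (MvPolynomial τ k →ₗ[k] k) := fun γ' => if γ' = γ then ev else 0
  let pr : ∀ β : ι → ℕ, ((β : Finset.Iic p) → K β) →ₗ[k] MvPolynomial τ k := fun β =>
    if hβ : β ∈ Finset.Iic p then (K β).subtype ∘ₗ LinearMap.proj (φ := fun b : Finset.Iic p => K b) ⟨β, hβ⟩ else 0
  have hpr : ∀ (w : (β : Finset.Iic p) → K β) β (hβ : β ∈ Finset.Iic p),
      pr β w = w ⟨β, hβ⟩ := by
    intro w β hβ
    simp only [pr, dif_pos hβ]
    rfl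
  let B : ((ι → ℕ) → (MvPolynomial τ k →ₗ[k] k)) →
      (((β : Finset.Iic p) → K β) →ₗ[k] ((α : Finset.Iic p) → (L α →ₗ[k] k))) := fun F =>
    LinearMap.pi fun α => ∑ β ∈ Finset.Iic p, if (α : ι → ℕ) + β ≤ p then
      (LinearMap.lcomp k k (L α).subtype) ∘ₗ
        ((LinearMap.mul k (MvPolynomial τ k)).compr₂ (F (α + β))).flip ∘ₗ pr β else 0
  have hB : ∀ F w (α : Finset.Iic p) (g : L α), B F w α g =
      ∑ β ∈ Finset.Iic p, if (α : ι → ℕ) + β ≤ p then F (α + β) (g * pr β w) else 0 := by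
    intro F w α g
    simp only [B, LinearMap.pi_apply, LinearMap.sum_apply]
    refine Finset.sum_congr rfl fun β _ => ?_
    split_ifs <;> rfl
  have hBE : ∀ w (α : Finset.Iic p) (g : L α), B E w α g =
      if (α : ι → ℕ) ≤ γ then ev g * ev (pr (γ - α) w) else 0 := by
    intro w α g
    rw [hB]
    split_ifs with h
    · rw [Finset.sum_eq_single_of_mem (γ - (α : ι → ℕ))
        (Finset.mem_Iic.2 (tsub_le_self.trans hγp))]
      · rw [add_tsub_cancel_of_le h, if_pos hγp]
        simp only [E, if_true]
        exact hevmul _ _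
      · intro β _ hβ
        have : (α : ι → ℕ) + β ≠ γ := fun h' => hβ (by rw [← h', add_tsub_cancel_left])
        simp [E, this]
    · refine Finset.sum_eq_zero fun β _ => ?_
      have : (α : ι → ℕ) + β ≠ γ := fun h' => h (h' ▸ le_self_add)
      simp [E, this]
  -- The kernel of `B E` consists of families lying in the reduced pieces `K'`, and functionals in
  -- its range vanish on the reduced pieces `L'`. A kernel element sent by `B F'` into that range is
  -- therefore orthogonal to `L'` under the smaller pairing, hence zero by induction.
  obtain ⟨t, ht⟩ := exists_add_smul_injective (B E) (B F') (by
    show ∀ w, B E w = 0 → B F' w ∈ LinearMap.range (B E) → w = 0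
    intro w hw hw'
    have hwK : ∀ β ≤ p, pr β w ∈ K' β := by
      intro β hβ
      have h0 : pr β w ∈ K β := by
        rw [hpr w β (Finset.mem_Iic.2 hβ)]
        exact Submodule.coe_mem _
      by_cases hact : actK β
      · simp only [K', if_pos hact]
        refine ⟨h0, ?_⟩
        have hαp : γ - β ≤ p := tsub_le_self.trans hγp
        have h1 := hBE w ⟨γ - β, Finset.mem_Iic.2 hαp⟩ ⟨gL (γ - β), hgL _⟩
        rw [hw] at h1
        simp only [Pi.zero_apply, LinearMap.zero_apply, tsub_le_self, if_true,
          tsub_tsub_cancel_of_le hact.1] at h1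
        exact (mul_eq_zero.1 h1.symm).resolve_left (hevL _ hαp hact.2.2)
      · rwa [houtK β hact]
    have h2 := hF' (fun β => pr β w) hwK (by
      intro α hα g hg
      obtain ⟨v, hv⟩ := hw'
      have h3 := hB F' w ⟨α, Finset.mem_Iic.2 hα⟩ ⟨g, hL'le α hg⟩
      rw [← h3, ← hv, hBE]
      split_ifs with h
      · by_cases hact : actL α
        · simp only [L', if_pos hact] at hg
          have : ev g = 0 := hg.2
          simp only [this, zero_mul]
        · simp only [actL, not_and_or, not_not] at hact
          rcases hact with hact | hact | hact
          · exact absurd h hact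
          · have h5 := hL'le α hg
            rw [hact, Submodule.mem_bot] at h5
            simp [h5]
          · have h5 : pr (γ - α) v ∈ K (γ - α) := by
              rw [hpr v _ (Finset.mem_Iic.2 (tsub_le_self.trans hγp))]
              exact Submodule.coe_mem _
            rw [hact, Submodule.mem_bot] at h5
            simp [h5]
      · rfl)
    funext β
    have h4 := h2 β (Finset.mem_Iic.1 β.2)
    simp only [hpr w β β.2] at h4
    exact Subtype.ext h4)
  refine ⟨fun γ' => E γ' + t • F' γ', fun h hh hzero β hβ => ?_⟩
  let w : (β : Finset.Iic p) → K β := fun β => ⟨h β, hh β (Finset.mem_Iic.1 β.2)⟩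
  have hw : w = 0 := by
    refine ht w ?_
    funext α
    refine LinearMap.ext fun g => ?_
    have h1 := hzero α (Finset.mem_Iic.1 α.2) g g.2
    simp only [Pi.add_apply, Pi.smul_apply, LinearMap.add_apply, LinearMap.smul_apply, hB,
      Pi.zero_apply, LinearMap.zero_apply]
    refine Eq.trans ?_ h1
    rw [Finset.smul_sum, ← Finset.sum_add_distrib]
    refine Finset.sum_congr rfl fun β hβ => ?_
    rw [hpr w β hβ]
    split_ifs
    · rfl
    · simp
  exact congrArg Subtype.val (congrFun hw ⟨β, Finset.mem_Iic.2 hβ⟩)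

end Pairing

/-! ### Specialization to spaces spanned by monomials. -/

section MonomialPairing

variable {k : Type*} [Field k] {τ ι : Type*}

theorem finrank_span_monomial (S : Finset (τ →₀ ℕ)) :
    Module.finrank k (Submodule.span k ((fun m => monomial m (1 : k)) '' (S : Set (τ →₀ ℕ)))) =
      S.card := by
  have h1 : LinearIndependent k (fun m : S => monomial (m : τ →₀ ℕ) (1 : k)) := by
    have h2 := (basisMonomials τ k).linearIndependent.comp ((↑) : S → (τ →₀ ℕ))
      Subtype.val_injective
    have h3 : (⇑(basisMonomials τ k) ∘ ((↑) : S → (τ →₀ ℕ))) =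
        fun m : S => monomial (m : τ →₀ ℕ) (1 : k) := by
      funext m
      simp
    rwa [h3] at h2
  have h4 := finrank_span_eq_card h1
  rw [Fintype.card_coe] at h4
  rw [← h4]
  have h5 : (fun m => monomial m (1 : k)) '' (S : Set (τ →₀ ℕ)) =
      Set.range (fun m : S => monomial (m : τ →₀ ℕ) (1 : k)) := by
    ext f
    simp
  rw [h5]

open scoped Classical in
/-- Monomial form of generic nondegeneracy: for two finite sets `A`, `B` of monomials, graded by
additive classes in a box with decreasing numbers of monomials in each class, and `#B ≤ #A`,
there is a function `c` on monomials for which the truncated catalecticant matrix `c (a + b)` has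
independent columns. -/
theorem exists_catalecticant_nondegenerate [Fintype ι] [Infinite k]
    (cl : (τ →₀ ℕ) →+ (ι → ℕ)) (p : ι → ℕ) (A B : Finset (τ →₀ ℕ))
    (hA : ∀ a ∈ A, cl a ≤ p) (hB : ∀ b ∈ B, cl b ≤ p)
    (hantiA : ∀ α β, α ≤ β → β ≤ p →
      (A.filter fun a => cl a = β).card ≤ (A.filter fun a => cl a = α).card)
    (hantiB : ∀ α β, α ≤ β → β ≤ p →
      (B.filter fun a => cl a = β).card ≤ (B.filter fun a => cl a = α).card)
    (hcard : B.card ≤ A.card) :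
    ∃ c : (τ →₀ ℕ) → k, ∀ x : (τ →₀ ℕ) → k,
      (∀ a ∈ A, ∑ b ∈ B, (if cl a + cl b ≤ p then x b * c (a + b) else 0) = 0) →
      ∀ b ∈ B, x b = 0 := by
  let sp : Finset (τ →₀ ℕ) → Submodule k (MvPolynomial τ k) := fun S =>
    Submodule.span k ((fun m => monomial m (1 : k)) '' (S : Set (τ →₀ ℕ)))
  have hsp : ∀ S, Module.finrank k (sp S) = S.card := fun S => finrank_span_monomial S
  have hfd : ∀ S, FiniteDimensional k (sp S) := fun S =>
    FiniteDimensional.span_of_finite k (S.finite_toSet.image _)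
  have hsum : ∀ S : Finset (τ →₀ ℕ), (∀ a ∈ S, cl a ≤ p) →
      ∑ β ∈ Finset.Iic p, (S.filter fun a => cl a = β).card = S.card := fun S hS =>
    (Finset.card_eq_sum_card_fiberwise fun a ha => Finset.mem_coe.2 (Finset.mem_Iic.2 (hS a ha))).symm
  let L : (ι → ℕ) → Submodule k (MvPolynomial τ k) := fun α => sp (A.filter fun a => cl a = α)
  let K : (ι → ℕ) → Submodule k (MvPolynomial τ k) := fun α => sp (B.filter fun a => cl a = α)
  have : ∀ α, FiniteDimensional k (L α) := fun α => hfd _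
  have : ∀ α, FiniteDimensional k (K α) := fun α => hfd _
  obtain ⟨F, hF⟩ := exists_nondegenerate (k := k) (τ := τ) p _ L K
    (fun α β h1 h2 => by simpa only [L, hsp] using hantiA α β h1 h2)
    (fun α β h1 h2 => by simpa only [K, hsp] using hantiB α β h1 h2) rfl
    (by simp only [L, K, hsp]; rw [hsum A hA, hsum B hB]; exact hcard)
  refine ⟨fun m => F (cl m) (monomial m 1), fun x hx b hb => ?_⟩
  have h1 := hF (fun β => ∑ b ∈ B.filter (fun b => cl b = β), monomial b (x b))
    (fun β _ => by
      refine Submodule.sum_mem _ fun b hb => ?_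
      have h2 : monomial b (x b) = x b • monomial b (1 : k) := by
        rw [smul_monomial, smul_eq_mul, mul_one]
      rw [h2]
      exact Submodule.smul_mem _ _ (Submodule.subset_span ⟨b, hb, rfl⟩))
    (fun α _ g hg => by
      let h' : (ι → ℕ) → MvPolynomial τ k := fun β =>
        ∑ b ∈ B.filter (fun b => cl b = β), monomial b (x b)
      let Ψ : MvPolynomial τ k →ₗ[k] k := ∑ β ∈ Finset.Iic p,
        if α + β ≤ p then F (α + β) ∘ₗ (LinearMap.mul k (MvPolynomial τ k)).flip (h' β) else 0
      have hΨ : ∀ g, Ψ g = ∑ β ∈ Finset.Iic p,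
          if α + β ≤ p then F (α + β) (g * h' β) else 0 := by
        intro g
        simp only [Ψ, LinearMap.sum_apply]
        refine Finset.sum_congr rfl fun β _ => ?_
        split_ifs <;> rfl
      have hker : L α ≤ LinearMap.ker Ψ := by
        refine Submodule.span_le.2 ?_
        rintro _ ⟨a, ha, rfl⟩
        obtain ⟨haA, rfl⟩ := Finset.mem_filter.1 (Finset.mem_coe.1 ha)
        refine (hΨ _).trans ?_
        refine Eq.trans ?_ (hx a haA)
        rw [← Finset.sum_fiberwise_of_maps_to (t := Finset.Iic p) (g := cl)
          (fun b hb => Finset.mem_Iic.2 (hB b hb))]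
        refine Finset.sum_congr rfl fun β _ => ?_
        split_ifs with h
        · rw [Finset.mul_sum, map_sum]
          refine Finset.sum_congr rfl fun b hb => ?_
          have hbβ := (Finset.mem_filter.1 hb).2
          rw [if_pos (by rwa [hbβ]), monomial_mul, one_mul]
          show _ = x b * F (cl (a + b)) (monomial (a + b) 1)
          rw [map_add, hbβ]
          have h2 : monomial (a + b) (x b) = x b • monomial (a + b) (1 : k) := by
            rw [smul_monomial, smul_eq_mul, mul_one]
          rw [h2, map_smul, smul_eq_mul]
        · refine (Finset.sum_eq_zero fun b hb => ?_).symm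
          rw [if_neg (by rwa [(Finset.mem_filter.1 hb).2])]
      exact (hΨ g).symm.trans (hker hg))
    (cl b) (hB b hb)
  have h2 := congrArg (coeff b) h1
  rw [coeff_sum, coeff_zero, Finset.sum_eq_single_of_mem (s := B.filter fun b' => cl b' = cl b) b
    (Finset.mem_filter.2 ⟨hb, rfl⟩)
    (fun b' _ hne => by rw [coeff_monomial, if_neg hne]), coeff_monomial, if_pos rfl] at h2
  exact h2

end MonomialPairing

/-! ### Several generic forms, encoded by marker variables. -/

section Multiindex

variable {r : ℕ}

/-- The class of a multi-index: its entries at the constrained positions. -/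
def idxClass (I : Finset (Fin r)) : (Fin r →₀ ℕ) →+ (Fin r → ℕ) where
  toFun D i := if i ∈ I then D i else 0
  map_zero' := by
    funext i
    simp
  map_add' D E := by
    funext i
    simp only [Pi.add_apply, Finsupp.add_apply]
    split_ifs <;> rfl

theorem idxClass_apply (I : Finset (Fin r)) (D : Fin r →₀ ℕ) (i : Fin r) :
    idxClass I D i = if i ∈ I then D i else 0 := rfl

theorem idxClass_le_iff {I : Finset (Fin r)} {D : Fin r →₀ ℕ} {p : Fin r → ℕ} :
    idxClass I D ≤ p ↔ ∀ i ∈ I, D i ≤ p i := by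
  constructor
  · intro h i hi
    have := h i
    rwa [idxClass_apply, if_pos hi] at this
  · intro h i
    rw [idxClass_apply]
    split_ifs with hi
    · exact h i hi
    · exact Nat.zero_le _

/-- Catalecticant form of generic nondegeneracy with several generic forms, which label the rows
(`v = 1`) or the columns (`s = 1`). -/
theorem exists_catalecticant_nondegenerate_of_classes {k : Type*} [Field k] [Infinite k]
    (s v : ℕ) (I : Finset (Fin r)) (p : Fin r → ℕ) (A B : Finset (Fin r →₀ ℕ))
    (hA : ∀ a ∈ A, idxClass I a ≤ p) (hB : ∀ b ∈ B, idxClass I b ≤ p)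
    (hantiA : ∀ α β, α ≤ β → β ≤ p →
      (A.filter fun a => idxClass I a = β).card ≤ (A.filter fun a => idxClass I a = α).card)
    (hantiB : ∀ α β, α ≤ β → β ≤ p →
      (B.filter fun a => idxClass I a = β).card ≤ (B.filter fun a => idxClass I a = α).card)
    (hcard : v * B.card ≤ s * A.card) :
    ∃ c : Fin s → Fin v → (Fin r →₀ ℕ) → k, ∀ x : Fin v → (Fin r →₀ ℕ) → k,
      (∀ t, ∀ a ∈ A, ∑ l : Fin v, ∑ b ∈ B,
        (if ∀ i ∈ I, (a + b) i ≤ p i then x l b * c t l (a + b) else 0) = 0) →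
      ∀ l, ∀ b ∈ B, x l b = 0 := by
  classical
  -- A marker variable is added for each row label and each column label. The product of row
  -- monomial `(t, E)` and column monomial `(l, D)` then remembers `t`, `l` and `D + E`, so one
  -- function on monomials in `T` gives independent functions `c t l`. Markers do not enter the
  -- class.
  let T := (Fin s ⊕ Fin v) ⊕ Fin r
  let emb : (Fin r →₀ ℕ) →+ (T →₀ ℕ) := Finsupp.mapDomain.addMonoidHom Sum.inr
  have hemb : ∀ D i, emb D (Sum.inr i) = D i := fun D i =>
    Finsupp.mapDomain_apply Sum.inr_injective D i
  have hemb' : ∀ D (i : Fin s ⊕ Fin v), emb D (Sum.inl i) = 0 := fun D i =>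
    Finsupp.mapDomain_of_notMem_range _ _ (by simp)
  let fA : Fin s × (Fin r →₀ ℕ) → (T →₀ ℕ) := fun q =>
    Finsupp.single (Sum.inl (Sum.inl q.1)) 1 + emb q.2
  let fB : Fin v × (Fin r →₀ ℕ) → (T →₀ ℕ) := fun q =>
    Finsupp.single (Sum.inl (Sum.inr q.1)) 1 + emb q.2
  let cl : (T →₀ ℕ) →+ (Fin r → ℕ) :=
    { toFun := fun m i => if i ∈ I then m (Sum.inr i) else 0
      map_zero' := by funext i; simp
      map_add' := fun D E => by
        funext i
        simp only [Pi.add_apply, Finsupp.add_apply]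
        split_ifs <;> rfl }
  have hclA : ∀ q, cl (fA q) = idxClass I q.2 := by
    intro q
    funext i
    show (if i ∈ I then fA q (Sum.inr i) else 0) = if i ∈ I then q.2 i else 0
    simp only [fA, Finsupp.add_apply, hemb]
    rw [Finsupp.single_eq_of_ne (by simp), zero_add]
  have hclB : ∀ q, cl (fB q) = idxClass I q.2 := by
    intro q
    funext i
    show (if i ∈ I then fB q (Sum.inr i) else 0) = if i ∈ I then q.2 i else 0
    simp only [fB, Finsupp.add_apply, hemb]
    rw [Finsupp.single_eq_of_ne (by simp), zero_add]
  have hfA : Function.Injective fA := by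
    intro q q' h
    have h1 : q.2 = q'.2 := by
      ext i
      have := DFunLike.congr_fun h (Sum.inr i)
      simp only [fA, Finsupp.add_apply, hemb] at this
      rwa [Finsupp.single_eq_of_ne (by simp), Finsupp.single_eq_of_ne (by simp), zero_add,
        zero_add] at this
    have h2 : q.1 = q'.1 := by
      have := DFunLike.congr_fun h (Sum.inl (Sum.inl q.1))
      simp only [fA, Finsupp.add_apply, hemb', add_zero, Finsupp.single_eq_same] at this
      by_contra hne
      rw [Finsupp.single_eq_of_ne (by simpa using hne)] at this
      exact one_ne_zero this
    exact Prod.ext h2 h1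
  have hfB : Function.Injective fB := by
    intro q q' h
    have h1 : q.2 = q'.2 := by
      ext i
      have := DFunLike.congr_fun h (Sum.inr i)
      simp only [fB, Finsupp.add_apply, hemb] at this
      rwa [Finsupp.single_eq_of_ne (by simp), Finsupp.single_eq_of_ne (by simp), zero_add,
        zero_add] at this
    have h2 : q.1 = q'.1 := by
      have := DFunLike.congr_fun h (Sum.inl (Sum.inr q.1))
      simp only [fB, Finsupp.add_apply, hemb', add_zero, Finsupp.single_eq_same] at this
      by_contra hne
      rw [Finsupp.single_eq_of_ne (by simpa using hne)] at this
      exact one_ne_zero this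
    exact Prod.ext h2 h1
  have hfib : ∀ {n : ℕ} (f : Fin n × (Fin r →₀ ℕ) → (T →₀ ℕ)) (_ : Function.Injective f)
      (_ : ∀ q, cl (f q) = idxClass I q.2) (S : Finset (Fin r →₀ ℕ)) (α : Fin r → ℕ),
      (((Finset.univ ×ˢ S).image f).filter fun a => cl a = α).card =
        n * (S.filter fun a => idxClass I a = α).card := by
    intro n f hf hcl S α
    rw [Finset.filter_image, Finset.card_image_of_injective _ hf]
    have : (Finset.univ ×ˢ S).filter (fun q : Fin n × (Fin r →₀ ℕ) => cl (f q) = α) =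
        Finset.univ ×ˢ (S.filter fun a => idxClass I a = α) := by
      ext q
      simp [hcl]
    rw [this, Finset.card_product, Finset.card_univ, Fintype.card_fin]
  obtain ⟨c, hc⟩ := exists_catalecticant_nondegenerate (k := k) cl p
    ((Finset.univ ×ˢ A).image fA) ((Finset.univ ×ˢ B).image fB)
    (by
      intro a ha
      obtain ⟨q, hq, rfl⟩ := Finset.mem_image.1 ha
      rw [hclA]
      exact hA _ (Finset.mem_product.1 hq).2)
    (by
      intro a ha
      obtain ⟨q, hq, rfl⟩ := Finset.mem_image.1 ha
      rw [hclB]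
      exact hB _ (Finset.mem_product.1 hq).2)
    (fun α β h1 h2 => by
      have := Nat.mul_le_mul_left s (hantiA α β h1 h2)
      rw [← hfib fA hfA hclA, ← hfib fA hfA hclA] at this
      convert this)
    (fun α β h1 h2 => by
      have := Nat.mul_le_mul_left v (hantiB α β h1 h2)
      rw [← hfib fB hfB hclB, ← hfib fB hfB hclB] at this
      convert this)
    (by
      rw [Finset.card_image_of_injective _ hfA, Finset.card_image_of_injective _ hfB,
        Finset.card_product, Finset.card_product, Finset.card_univ, Finset.card_univ,
        Fintype.card_fin, Fintype.card_fin]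
      exact hcard)
  refine ⟨fun t l m => c (Finsupp.single (Sum.inl (Sum.inl t)) 1 +
    Finsupp.single (Sum.inl (Sum.inr l)) 1 + emb m), fun x hx l b hb => ?_⟩
  let y : (T →₀ ℕ) → k := Function.extend fB (fun q => x q.1 q.2) 0
  have hy : ∀ q, y (fB q) = x q.1 q.2 := fun q => hfB.extend_apply _ _ q
  have h1 := hc y (by
    intro a ha
    obtain ⟨⟨t, E⟩, hq, rfl⟩ := Finset.mem_image.1 ha
    refine Eq.trans ?_ (hx t E (Finset.mem_product.1 hq).2)
    rw [Finset.sum_image hfB.injOn, Finset.sum_product]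
    refine Finset.sum_congr rfl fun l _ => Finset.sum_congr rfl fun D _ => ?_
    rw [hy, hclA, hclB, ← map_add]
    refine if_congr idxClass_le_iff ?_ rfl
    congr 2
    simp only [fA, fB, map_add]
    abel) (fB (l, b)) (Finset.mem_image_of_mem _ (Finset.mem_product.2 ⟨Finset.mem_univ _, hb⟩))
  rwa [hy] at h1

end Multiindex

/-! ### Differentiation as contraction, and levelness. -/

section Apolarity

variable {k : Type*} [Field k] {r : ℕ}

/-- The normalized coefficient `E! · (coefficient of x^E)`, i.e. the value of `∂^E` at the
origin. -/
noncomputable def divCoeff (E : Fin r →₀ ℕ) : MvPolynomial (Fin r) k →ₗ[k] k :=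
  ((∏ i, (E i).factorial : ℕ) : k) • lcoeff k E

theorem divCoeff_apply (E : Fin r →₀ ℕ) (f : MvPolynomial (Fin r) k) :
    divCoeff E f = ((∏ i, (E i).factorial : ℕ) : k) * coeff E f := rfl

theorem cast_prod_factorial_ne_zero [CharZero k] (E : Fin r →₀ ℕ) :
    ((∏ i, (E i).factorial : ℕ) : k) ≠ 0 :=
  Nat.cast_ne_zero.2 (Finset.prod_ne_zero_iff.2 fun _ _ => Nat.factorial_ne_zero _)

theorem eq_zero_of_divCoeff [CharZero k] {f : MvPolynomial (Fin r) k}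
    (h : ∀ E, divCoeff E f = 0) : f = 0 := by
  ext E
  exact (mul_eq_zero.1 (h E)).resolve_left (cast_prod_factorial_ne_zero E)

theorem divCoeff_eq_zero_of_degree_ne {f : MvPolynomial (Fin r) k} {j : ℕ}
    (hf : f.IsHomogeneous j) {E : Fin r →₀ ℕ} (hE : E.degree ≠ j) : divCoeff E f = 0 := by
  rw [divCoeff_apply, hf.coeff_eq_zero hE, mul_zero]

theorem divCoeff_pderiv (E : Fin r →₀ ℕ) (i : Fin r) (f : MvPolynomial (Fin r) k) :
    divCoeff E (pderiv i f) = divCoeff (Finsupp.single i 1 + E) f := by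
  have h : ∏ l, ((Finsupp.single i 1 + E : Fin r →₀ ℕ) l).factorial =
      (E i + 1) * ∏ l, (E l).factorial := by
    rw [← Finset.mul_prod_erase _ _ (Finset.mem_univ i),
      ← Finset.mul_prod_erase _ (fun l => (E l).factorial) (Finset.mem_univ i), ← mul_assoc]
    congr 1
    · rw [Finsupp.add_apply, Finsupp.single_eq_same, add_comm 1, Nat.factorial_succ]
    · refine Finset.prod_congr rfl fun l hl => ?_
      rw [Finsupp.add_apply, Finsupp.single_eq_of_ne (Finset.ne_of_mem_erase hl), zero_add]
  rw [divCoeff_apply, divCoeff_apply, h, coeff_pderiv, add_comm E]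
  push_cast
  ring

/-- With coefficients normalized by factorials, differentiation is a shift of indices without
constants, so the matrices occurring below are genuine catalecticants with entries depending only on
`D + E`. -/
theorem divCoeff_iterPartialD (D : Fin r →₀ ℕ) :
    ∀ (E : Fin r →₀ ℕ) (f : MvPolynomial (Fin r) k),
      divCoeff E (iterPartialD D f) = divCoeff (D + E) f := by
  have hadd : ∀ D D' : Fin r →₀ ℕ,
      (∀ (E : Fin r →₀ ℕ) (f : MvPolynomial (Fin r) k),
        divCoeff E (iterPartialD D f) = divCoeff (D + E) f) →
      (∀ (E : Fin r →₀ ℕ) (f : MvPolynomial (Fin r) k),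
        divCoeff E (iterPartialD D' f) = divCoeff (D' + E) f) →
      ∀ (E : Fin r →₀ ℕ) (f : MvPolynomial (Fin r) k),
        divCoeff E (iterPartialD (D + D') f) = divCoeff (D + D' + E) f := by
    intro D D' h h' E f
    rw [iterPartialD_add, Module.End.mul_apply, h, h', ← add_assoc, add_comm D']
  induction D using Finsupp.induction_linear with
  | zero =>
    intro E f
    rw [iterPartialD_zero, zero_add, Module.End.one_apply]
  | add D D' h h' => exact hadd D D' h h'
  | single i n =>
    induction n with
    | zero =>
      intro E f
      rw [Finsupp.single_zero, iterPartialD_zero, zero_add, Module.End.one_apply]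
    | succ n ih =>
      rw [Finsupp.single_add]
      refine hadd _ _ ih fun E f => ?_
      rw [iterPartialD_single]
      exact divCoeff_pderiv E i f

theorem divCoeff_diffOp {F : MvPolynomial (Fin r) k} {S : Finset (Fin r →₀ ℕ)}
    (hS : F.support ⊆ S) (E : Fin r →₀ ℕ) (f : MvPolynomial (Fin r) k) :
    divCoeff E (diffOp F f) = ∑ D ∈ S, coeff D F * divCoeff (D + E) f := by
  have h1 : F = ∑ D ∈ S, monomial D (coeff D F) := by
    conv_lhs => rw [← support_sum_monomial_coeff F]
    refine Finset.sum_subset hS fun D _ hD => ?_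
    rw [notMem_support_iff.1 hD, map_zero]
  conv_lhs => rw [h1]
  rw [map_sum, LinearMap.sum_apply, map_sum]
  refine Finset.sum_congr rfl fun D _ => ?_
  rw [diffOp_monomial, map_smul, divCoeff_iterPartialD, smul_eq_mul]

theorem divCoeff_diffOp_monomial (D E : Fin r →₀ ℕ) (c : k) (f : MvPolynomial (Fin r) k) :
    divCoeff E (diffOp (monomial D c) f) = c * divCoeff (D + E) f := by
  rw [diffOp_monomial, map_smul, divCoeff_iterPartialD, smul_eq_mul]

theorem divCoeff_diffOp_X_mul (E : Fin r →₀ ℕ) (i : Fin r) (F f : MvPolynomial (Fin r) k) :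
    divCoeff E (diffOp (X i * F) f) = divCoeff (Finsupp.single i 1 + E) (diffOp F f) := by
  rw [map_mul, Module.End.mul_apply, diffOp_X, divCoeff_pderiv]

theorem diffOp_isHomogeneous [CharZero k] {F f : MvPolynomial (Fin r) k} {d j : ℕ}
    (hF : F.IsHomogeneous d) (hf : f.IsHomogeneous j) {E : Fin r →₀ ℕ}
    (hE : d + E.degree ≠ j) : divCoeff E (diffOp F f) = 0 := by
  rw [divCoeff_diffOp subset_rfl]
  refine Finset.sum_eq_zero fun D hD => ?_
  have hD' : D.degree = d := by
    by_contra h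
    exact (mem_support_iff.1 hD) (hF.coeff_eq_zero h)
  rw [divCoeff_eq_zero_of_degree_ne hf (by rw [map_add, hD']; exact hE), mul_zero]

theorem mem_annIdeal {W : Submodule k (MvPolynomial (Fin r) k)} {F : MvPolynomial (Fin r) k} :
    F ∈ annIdeal W ↔ ∀ f ∈ W, diffOp F f = 0 := Iff.rfl

theorem mem_annIdeal_sup {W W' : Submodule k (MvPolynomial (Fin r) k)}
    {F : MvPolynomial (Fin r) k} :
    F ∈ annIdeal (W ⊔ W') ↔ F ∈ annIdeal W ∧ F ∈ annIdeal W' := by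
  constructor
  · exact fun h => ⟨fun f hf => h f (Submodule.mem_sup_left hf),
      fun f hf => h f (Submodule.mem_sup_right hf)⟩
  · rintro ⟨h, h'⟩ f hf
    obtain ⟨g, hg, g', hg', rfl⟩ := Submodule.mem_sup.1 hf
    rw [map_add, h g hg, h' g' hg', add_zero]

theorem mem_annIdeal_span {ι : Type*} {w : ι → MvPolynomial (Fin r) k}
    {F : MvPolynomial (Fin r) k} :
    F ∈ annIdeal (Submodule.span k (Set.range w)) ↔ ∀ t, diffOp F (w t) = 0 := by
  constructor
  · exact fun h t => h _ (Submodule.subset_span ⟨t, rfl⟩)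
  · intro h
    have : Submodule.span k (Set.range w) ≤ LinearMap.ker (diffOp F) := by
      refine Submodule.span_le.2 ?_
      rintro _ ⟨t, rfl⟩
      exact h t
    exact fun f hf => this hf

theorem mem_gradedPiece {I : Ideal (MvPolynomial (Fin r) k)} {d : ℕ}
    {a : MvPolynomial (Fin r) k ⧸ I} :
    a ∈ gradedPiece I d ↔ ∃ F : MvPolynomial (Fin r) k, F.IsHomogeneous d ∧
      Ideal.Quotient.mk I F = a := Iff.rfl

section Level

variable [CharZero k] {W : Submodule k (MvPolynomial (Fin r) k)} {j : ℕ}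

theorem mem_annIdeal_of_degree_gt (hW : ∀ w ∈ W, w.IsHomogeneous j)
    {F : MvPolynomial (Fin r) k} {d : ℕ} (hF : F.IsHomogeneous d) (hd : j < d) :
    F ∈ annIdeal W := fun w hw =>
  eq_zero_of_divCoeff fun E => diffOp_isHomogeneous hF (hW w hw) (by omega)

theorem homogeneousComponent_mem_annIdeal (hW : ∀ w ∈ W, w.IsHomogeneous j)
    {F : MvPolynomial (Fin r) k} (hF : F ∈ annIdeal W) (d : ℕ) :
    homogeneousComponent d F ∈ annIdeal W := by
  intro w hw
  refine eq_zero_of_divCoeff fun E => ?_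
  by_cases hE : d + E.degree = j
  · have h1 := congrArg (divCoeff E) (hF w hw)
    rw [map_zero, divCoeff_diffOp subset_rfl] at h1
    have hsub : (homogeneousComponent d F).support ⊆ F.support := by
      intro D hD
      rw [mem_support_iff, coeff_homogeneousComponent] at hD
      rw [mem_support_iff]
      intro h
      rw [h, ite_self] at hD
      exact hD rfl
    rw [divCoeff_diffOp hsub, ← h1]
    refine Finset.sum_congr rfl fun D _ => ?_
    rw [coeff_homogeneousComponent]
    split_ifs with h
    · rfl
    · rw [divCoeff_eq_zero_of_degree_ne (hW w hw) (by rw [map_add]; omega), mul_zero, mul_zero]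
  · exact diffOp_isHomogeneous (homogeneousComponent_isHomogeneous d F) (hW w hw) hE

/-- Below degree `j` the form `F * w` has positive degree, so each of its coefficients is visible
after one further differentiation; characteristic zero is needed here. -/
theorem mem_annIdeal_of_X_mul_mem (hW : ∀ w ∈ W, w.IsHomogeneous j)
    {F : MvPolynomial (Fin r) k} {d : ℕ} (hF : F.IsHomogeneous d) (hd : d < j)
    (h : ∀ l, X l * F ∈ annIdeal W) : F ∈ annIdeal W := by
  intro w hw
  refine eq_zero_of_divCoeff fun E => ?_
  by_cases hE : d + E.degree = j
  · have hE0 : E ≠ 0 := by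
      rintro rfl
      rw [map_zero] at hE
      omega
    obtain ⟨l, hl⟩ := Finsupp.ne_iff.1 hE0
    have h1 : Finsupp.single l 1 + (E - Finsupp.single l 1) = E := by
      refine add_tsub_cancel_of_le ?_
      rw [Finsupp.single_le_iff]
      exact Nat.one_le_iff_ne_zero.2 hl
    rw [← h1, ← divCoeff_diffOp_X_mul, h l w hw, map_zero]
  · exact diffOp_isHomogeneous hF (hW w hw) hE

/-- If `a` is killed by all variables, its components in degrees below `j` annihilate `W` by
`mem_annIdeal_of_X_mul_mem`, and those above `j` do so for degree reasons; only the component in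
degree `j` survives. Finiteness holds since monomials of degree at most `j` span the quotient. -/
theorem isLevel_annIdeal (hW : ∀ w ∈ W, w.IsHomogeneous j) (hne : W ≠ ⊥) :
    IsLevel (annIdeal W) j where
  homogeneous F hF d := homogeneousComponent_mem_annIdeal hW hF d
  artinian := by
    let S : Finset (Fin r →₀ ℕ) :=
      (Finset.range (j + 1)).biUnion fun d => Finset.finsuppAntidiag Finset.univ d
    let φ : (S → k) →ₗ[k] (MvPolynomial (Fin r) k ⧸ annIdeal W) :=
      (Ideal.Quotient.mkₐ k (annIdeal W)).toLinearMap ∘ₗ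
        ∑ D : S, (monomial (D : Fin r →₀ ℕ)) ∘ₗ LinearMap.proj D
    refine Module.Finite.of_surjective φ ?_
    intro a
    obtain ⟨F, rfl⟩ := Ideal.Quotient.mk_surjective a
    refine ⟨fun D => coeff (D : Fin r →₀ ℕ) F, ?_⟩
    refine Ideal.Quotient.eq.2 fun w hw => eq_zero_of_divCoeff fun E => ?_
    rw [divCoeff_diffOp subset_rfl]
    refine Finset.sum_eq_zero fun D _ => ?_
    by_cases hD : D ∈ S
    · have h0 : coeff D ((∑ D : S, (monomial (D : Fin r →₀ ℕ)) ∘ₗ LinearMap.proj D :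
          (S → k) →ₗ[k] MvPolynomial (Fin r) k) (fun D => coeff (D : Fin r →₀ ℕ) F) - F) = 0 := by
        rw [coeff_sub, LinearMap.sum_apply, coeff_sum,
          Finset.sum_eq_single_of_mem ⟨D, hD⟩ (Finset.mem_univ _)]
        · simp
        · intro D' _ hne
          simp only [LinearMap.comp_apply, LinearMap.proj_apply, coeff_monomial]
          rw [if_neg fun h => hne (Subtype.ext h)]
      rw [h0, zero_mul]
    · rw [divCoeff_eq_zero_of_degree_ne (hW w hw), mul_zero]
      intro hdeg
      apply hD
      rw [map_add] at hdeg
      refine Finset.mem_biUnion.2 ⟨D.degree, Finset.mem_range.2 (by omega), ?_⟩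
      rw [Finset.mem_finsuppAntidiag]
      exact ⟨(Finsupp.degree_eq_sum D).symm, Finset.subset_univ _⟩
  top_ne_bot := by
    obtain ⟨w, hw, hw0⟩ := Submodule.exists_mem_ne_zero_of_ne_bot hne
    obtain ⟨J, hJ⟩ := MvPolynomial.ne_zero_iff.1 hw0
    have hdeg : J.degree = j := by
      by_contra h
      exact hJ ((hW w hw).coeff_eq_zero h)
    intro hbot
    have h1 : Ideal.Quotient.mk (annIdeal W) (monomial J (1 : k)) ∈ gradedPiece (annIdeal W) j :=
      mem_gradedPiece.2 ⟨_, isHomogeneous_monomial _ hdeg, rfl⟩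
    rw [hbot, Submodule.mem_bot, Ideal.Quotient.eq_zero_iff_mem] at h1
    have h2 := congrArg (divCoeff 0) (h1 w hw)
    rw [divCoeff_diffOp_monomial, map_zero, add_zero, one_mul, divCoeff_apply] at h2
    exact mul_ne_zero (cast_prod_factorial_ne_zero J) hJ h2
  eq_bot_of_lt d hd := by
    rw [eq_bot_iff]
    rintro a ha
    obtain ⟨F, hF, rfl⟩ := mem_gradedPiece.1 ha
    rw [Submodule.mem_bot, Ideal.Quotient.eq_zero_iff_mem]
    exact mem_annIdeal_of_degree_gt hW hF hd
  socle_eq := by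
    ext a
    constructor
    · intro ha
      obtain ⟨F, rfl⟩ := Ideal.Quotient.mk_surjective a
      have hX : ∀ l, X l * F ∈ annIdeal W := by
        intro l
        have h1 := ha (Ideal.Quotient.mk _ (X l)) (mem_gradedPiece.2 ⟨_, isHomogeneous_X _ _, rfl⟩)
        rw [← map_mul, Ideal.Quotient.eq_zero_iff_mem, mul_comm] at h1
        exact h1
      have hcomp : ∀ d, d ≠ j → homogeneousComponent d F ∈ annIdeal W := by
        intro d hd
        rcases lt_or_gt_of_ne hd with hd | hd
        · refine mem_annIdeal_of_X_mul_mem hW (homogeneousComponent_isHomogeneous d F) hd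
            fun l => ?_
          have h2 := homogeneousComponent_mem_annIdeal hW (hX l) (d + 1)
          have h3 : homogeneousComponent (d + 1) (X l * F) = X l * homogeneousComponent d F := by
            ext D
            rw [coeff_homogeneousComponent]
            by_cases hl : l ∈ D.support
            · have h1 : Finsupp.single l 1 + (D - Finsupp.single l 1) = D := by
                refine add_tsub_cancel_of_le ?_
                rw [Finsupp.single_le_iff]
                exact Nat.one_le_iff_ne_zero.2 (Finsupp.mem_support_iff.1 hl)
              rw [← h1, coeff_X_mul, coeff_X_mul, coeff_homogeneousComponent, map_add,
                Finsupp.degree_single]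
              refine if_congr ?_ rfl rfl
              omega
            · rw [coeff_X_mul', coeff_X_mul', if_neg hl, if_neg hl, ite_self]
          rwa [h3] at h2
        · exact mem_annIdeal_of_degree_gt hW (homogeneousComponent_isHomogeneous d F) hd
      refine mem_gradedPiece.2 ⟨homogeneousComponent j F, homogeneousComponent_isHomogeneous j F,
        Ideal.Quotient.eq.2 ?_⟩
      rw [← neg_mem_iff, neg_sub]
      have h4 : F - homogeneousComponent j F =
          ∑ d ∈ (Finset.range (F.totalDegree + 1)).erase j, homogeneousComponent d F := by
        by_cases hj : j ∈ Finset.range (F.totalDegree + 1)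
        · conv_lhs => rw [← sum_homogeneousComponent F, map_sum]
          rw [← Finset.add_sum_erase _ _ hj, ← map_sum, sum_homogeneousComponent]
          ring
        · rw [Finset.erase_eq_of_notMem hj, sum_homogeneousComponent,
            homogeneousComponent_eq_zero _ _ (by simpa using hj), sub_zero]
      rw [h4]
      exact Ideal.sum_mem _ fun d hd => hcomp d (Finset.ne_of_mem_erase hd)
    · intro ha l hl
      obtain ⟨F, hF, rfl⟩ := mem_gradedPiece.1 ha
      obtain ⟨G, hG, rfl⟩ := mem_gradedPiece.1 hl
      rw [← map_mul, Ideal.Quotient.eq_zero_iff_mem]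
      exact mem_annIdeal_of_degree_gt hW (hF.mul hG) (by omega)

end Level

end Apolarity

/-! ### Bounded multi-indices and the sizes of their classes. -/

section BoundedIndices

variable {r : ℕ}

/-- The multi-indices of degree `d` whose entries at the positions in `I` are bounded by `p`. -/
def boundedIdx (I : Finset (Fin r)) (p : Fin r → ℕ) (d : ℕ) : Finset (Fin r →₀ ℕ) :=
  (Finset.finsuppAntidiag Finset.univ d).filter fun D => ∀ i ∈ I, D i ≤ p i

theorem mem_boundedIdx {I : Finset (Fin r)} {p : Fin r → ℕ} {d : ℕ} {D : Fin r →₀ ℕ} :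
    D ∈ boundedIdx I p d ↔ D.degree = d ∧ ∀ i ∈ I, D i ≤ p i := by
  rw [boundedIdx, Finset.mem_filter, Finset.mem_finsuppAntidiag, Finsupp.degree_eq_sum]
  simp

/-- Lowering the exponents from class `β` to class `α` and giving the lost degree to the free
variable `l` is injective. The hypothesis on `A` says exactly that such moves stay inside `A`. -/
theorem card_fiber_antitone {I : Finset (Fin r)} {l : Fin r} (hl : l ∉ I) {d : ℕ}
    {A : Finset (Fin r →₀ ℕ)} (hdeg : ∀ D ∈ A, D.degree = d)
    (hA : ∀ D ∈ A, ∀ D' : Fin r →₀ ℕ, D'.degree = d → (∀ i ∈ I, D' i ≤ D i) →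
      (∀ i ∉ I, i ≠ l → D' i = D i) → D l ≤ D' l → D' ∈ A) (α β : Fin r → ℕ) (hαβ : α ≤ β) :
    (A.filter fun D => idxClass I D = β).card ≤ (A.filter fun D => idxClass I D = α).card := by
  let δ : Fin r →₀ ℕ := Finsupp.equivFunOnFinite.symm (β - α)
  have hδ : ∀ i, δ i = β i - α i := fun i => rfl
  have key : ∀ D ∈ A.filter (fun D => idxClass I D = β),
      (∀ i ∈ I, D i = β i) ∧ (∀ i ∉ I, β i = 0) ∧ δ ≤ D := by
    intro D hD
    have h1 := (Finset.mem_filter.1 hD).2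
    have h2 : ∀ i ∈ I, D i = β i := fun i hi => by
      rw [← h1, idxClass_apply, if_pos hi]
    have h3 : ∀ i ∉ I, β i = 0 := fun i hi => by
      rw [← h1, idxClass_apply, if_neg hi]
    refine ⟨h2, h3, fun i => ?_⟩
    rw [hδ]
    by_cases hi : i ∈ I
    · rw [h2 i hi]
      exact Nat.sub_le _ _
    · rw [h3 i hi, Nat.zero_sub]
      exact Nat.zero_le _
  refine Finset.card_le_card_of_injOn (fun D => (D - δ) + Finsupp.single l δ.degree) ?_ ?_
  · intro D hD
    obtain ⟨h1, h2, h3⟩ := key D (Finset.mem_coe.1 hD)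
    have hne : ∀ i ∈ I, i ≠ l := fun i hi h => hl (h ▸ hi)
    have hmem := (Finset.mem_filter.1 (Finset.mem_coe.1 hD)).1
    have hval : ∀ i ≠ l, ((D - δ) + Finsupp.single l δ.degree : Fin r →₀ ℕ) i =
        D i - (β i - α i) := by
      intro i hi
      rw [Finsupp.add_apply, Finsupp.single_eq_of_ne hi, add_zero, Finsupp.tsub_apply, hδ]
    refine Finset.mem_coe.2 (Finset.mem_filter.2 ⟨hA D hmem _ ?_ ?_ ?_ ?_, ?_⟩)
    · rw [map_add, Finsupp.degree_single, ← map_add, tsub_add_cancel_of_le h3, hdeg D hmem]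
    · intro i hi
      rw [hval i (hne i hi)]
      exact Nat.sub_le _ _
    · intro i hi hil
      rw [hval i hil, h2 i hi, Nat.zero_sub, Nat.sub_zero]
    · rw [Finsupp.add_apply, Finsupp.tsub_apply, hδ, h2 l hl, Nat.zero_sub, Nat.sub_zero]
      exact Nat.le_add_right _ _
    · funext i
      have h4 : α i ≤ β i := hαβ i
      rw [idxClass_apply]
      split_ifs with hi
      · rw [hval i (hne i hi), h1 i hi]
        omega
      · have := h2 i hi
        omega
  · intro D hD D' hD' h
    have h3 := (key D (Finset.mem_coe.1 hD)).2.2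
    have h3' := (key D' (Finset.mem_coe.1 hD')).2.2
    have h4 : D - δ = D' - δ := add_right_cancel h
    rw [← tsub_add_cancel_of_le h3, h4, tsub_add_cancel_of_le h3']

end BoundedIndices

/-! ### From one good point to a dense open set. -/

section Generic

variable {k : Type*} [Field k]

/-- Independence of the columns of a matrix of polynomials at one point persists off a
hypersurface. -/
theorem exists_polynomial_of_mulVec_injective {σ R S : Type*} [Fintype R] [Fintype S]
    (N : Matrix R S (MvPolynomial σ k)) (C₀ : σ → k)
    (h : ∀ x, (N.map (eval C₀)).mulVec x = 0 → x = 0) :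
    ∃ Q : MvPolynomial σ k, Q ≠ 0 ∧
      ∀ C, eval C Q ≠ 0 → ∀ x, (N.map (eval C)).mulVec x = 0 → x = 0 := by
  classical
  obtain ⟨ρ, hρ⟩ := LinearMap.exists_leftInverse_of_injective (N.map (eval C₀)).mulVecLin
    (LinearMap.ker_eq_bot'.2 h)
  let P : Matrix S R k := LinearMap.toMatrix' ρ
  have hP : P * N.map (eval C₀) = 1 := by
    have := congrArg LinearMap.toMatrix' hρ
    rw [LinearMap.toMatrix'_comp, LinearMap.toMatrix'_id, ← Matrix.toLin'_apply',
      LinearMap.toMatrix'_toLin'] at this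
    exact this
  -- The left inverse at `C₀`, kept constant, makes `P' * N` square with determinant `1` at `C₀`.
  -- Where this determinant is nonzero, the columns are independent.
  let P' : Matrix S R (MvPolynomial σ k) := P.map MvPolynomial.C
  have hev : ∀ C : σ → k, eval C (P' * N).det =
      (P * N.map (eval C)).det := by
    intro C
    rw [RingHom.map_det, RingHom.mapMatrix_apply, Matrix.map_mul]
    congr 2
    ext i j
    simp [P']
  refine ⟨(P' * N).det, fun h0 => ?_, fun C hC x hx => ?_⟩
  · have := hev C₀
    rw [h0, hP, Matrix.det_one, map_zero] at this
    exact zero_ne_one this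
  · rw [hev] at hC
    have h1 : (P * N.map (eval C)).mulVec x = 0 := by
      rw [← Matrix.mulVec_mulVec, hx, Matrix.mulVec_zero]
    exact Matrix.eq_zero_of_mulVec_eq_zero hC h1

theorem isZariskiOpen_ne_zero {σ : Type*} (Q : MvPolynomial σ k) :
    IsZariskiOpen {C : σ → k | eval C Q ≠ 0} :=
  ⟨{Q}, by ext C; simp⟩

theorem isZariskiDense_ne_zero [Infinite k] {σ : Type*} {Q : MvPolynomial σ k} (hQ : Q ≠ 0) :
    IsZariskiDense {C : σ → k | eval C Q ≠ 0} := by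
  rintro _ ⟨S, rfl⟩ ⟨C, hC⟩
  simp only [Set.mem_compl_iff, Set.mem_ofPred_eq, not_forall] at hC
  obtain ⟨p, hp, hpC⟩ := hC
  have hp0 : p ≠ 0 := by
    rintro rfl
    exact hpC (map_zero _)
  obtain ⟨C', hC'⟩ : ∃ C', eval C' (Q * p) ≠ 0 := by
    by_contra! hcon
    exact mul_ne_zero hQ hp0 (MvPolynomial.funext fun x => by rw [hcon, map_zero])
  rw [map_mul, mul_ne_zero_iff] at hC'
  refine ⟨C', hC'.1, ?_⟩
  simp only [Set.mem_compl_iff, Set.mem_ofPred_eq, not_forall]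
  exact ⟨p, hp, hC'.2⟩

variable {r j n : ℕ} {K : List ℕ}

/-- The `t`-th generator of the subspace with coefficients `C`. -/
noncomputable def familyForm (C : Coeffs k r j K n) (t : Fin n) : MvPolynomial (Fin r) k :=
  ∑ J : {J // J ∈ constrainedIdx r K j}, monomial J.1 (C (t, J))

theorem spanFamily_eq (C : Coeffs k r j K n) :
    spanFamily C = Submodule.span k (Set.range (familyForm C)) := rfl

open scoped Classical in
theorem coeff_familyForm (C : Coeffs k r j K n) (t : Fin n) (m : Fin r →₀ ℕ) :
    coeff m (familyForm C t) = if h : m ∈ constrainedIdx r K j then C (t, ⟨m, h⟩) else 0 := by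
  rw [familyForm, coeff_sum]
  split_ifs with h
  · rw [Finset.sum_eq_single_of_mem ⟨m, h⟩ (Finset.mem_univ _)
      (fun J _ hJ => by
        rw [coeff_monomial, if_neg fun h' => hJ (Subtype.ext h')]), coeff_monomial, if_pos rfl]
  · refine Finset.sum_eq_zero fun J _ => ?_
    rw [coeff_monomial, if_neg]
    rintro rfl
    exact h J.2

theorem divCoeff_familyForm_of_notMem (C : Coeffs k r j K n) (t : Fin n) {m : Fin r →₀ ℕ}
    (h : m ∉ constrainedIdx r K j) : divCoeff m (familyForm C t) = 0 := by
  classical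
  rw [divCoeff_apply, coeff_familyForm, dif_neg h, mul_zero]

theorem familyForm_isHomogeneous (C : Coeffs k r j K n) (t : Fin n) :
    (familyForm C t).IsHomogeneous j := by
  refine IsHomogeneous.sum _ _ _ fun J _ => isHomogeneous_monomial _ ?_
  have h := (Finset.mem_filter.1 J.2).1
  rw [Finset.mem_finsuppAntidiag] at h
  rw [Finsupp.degree_eq_sum]
  exact h.1

/-- For general coefficients the catalecticant matrix with rows in `A` and columns in `B` has
independent columns. -/
theorem exists_generic_nondegenerate [CharZero k] {s v : ℕ} (g : Fin s × Fin v → Fin n)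
    (hg : Function.Injective g) (I : Finset (Fin r)) (p : Fin r → ℕ)
    (hK : constrainedIdx r K j = boundedIdx I p j) (A B : Finset (Fin r →₀ ℕ))
    (hdeg : ∀ a ∈ A, ∀ b ∈ B, (a + b).degree = j)
    (hA : ∀ a ∈ A, idxClass I a ≤ p) (hB : ∀ b ∈ B, idxClass I b ≤ p)
    (hantiA : ∀ α β, α ≤ β → β ≤ p →
      (A.filter fun a => idxClass I a = β).card ≤ (A.filter fun a => idxClass I a = α).card)
    (hantiB : ∀ α β, α ≤ β → β ≤ p →
      (B.filter fun a => idxClass I a = β).card ≤ (B.filter fun a => idxClass I a = α).card)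
    (hcard : v * B.card ≤ s * A.card) :
    ∃ Q : MvPolynomial (Fin n × {J // J ∈ constrainedIdx r K j}) k, Q ≠ 0 ∧
      ∀ C : Coeffs k r j K n, eval C Q ≠ 0 → ∀ x : Fin v → (Fin r →₀ ℕ) → k,
        (∀ t, ∀ a ∈ A, ∑ l : Fin v, ∑ b ∈ B,
          x l b * divCoeff (a + b) (familyForm C (g (t, l))) = 0) →
        ∀ l, ∀ b ∈ B, x l b = 0 := by
  classical
  obtain ⟨c, hc⟩ := exists_catalecticant_nondegenerate_of_classes (k := k) s v I p A B hA hB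
    hantiA hantiB hcard
  let N : Matrix (Fin s × A) (Fin v × B)
      (MvPolynomial (Fin n × {J // J ∈ constrainedIdx r K j}) k) := fun ρ κ =>
    if h : (ρ.2 + κ.2 : Fin r →₀ ℕ) ∈ constrainedIdx r K j then
      MvPolynomial.C ((∏ i, ((ρ.2 + κ.2 : Fin r →₀ ℕ) i).factorial : ℕ) : k) *
        X (g (ρ.1, κ.1), ⟨_, h⟩) else 0
  have hN : ∀ (C : Coeffs k r j K n) ρ κ, N.map (eval C) ρ κ =
      divCoeff (ρ.2 + κ.2 : Fin r →₀ ℕ) (familyForm C (g (ρ.1, κ.1))) := by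
    intro C ρ κ
    rw [Matrix.map_apply, divCoeff_apply, coeff_familyForm]
    simp only [N]
    split_ifs
    · rw [map_mul, eval_C, eval_X]
    · rw [map_zero, mul_zero]
  have hmul : ∀ (C : Coeffs k r j K n) (x : Fin v → (Fin r →₀ ℕ) → k) ρ,
      (N.map (eval C)).mulVec (fun κ => x κ.1 κ.2) ρ = ∑ l : Fin v, ∑ b ∈ B,
        x l b * divCoeff (ρ.2 + b : Fin r →₀ ℕ) (familyForm C (g (ρ.1, l))) := by
    intro C x ρ
    rw [Matrix.mulVec, dotProduct, Fintype.sum_prod_type]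
    refine Finset.sum_congr rfl fun l _ => ?_
    rw [← Finset.sum_coe_sort B]
    refine Finset.sum_congr rfl fun b _ => ?_
    rw [hN, mul_comm]
  let c' : Fin n → (Fin r →₀ ℕ) → k := Function.extend g (fun q => c q.1 q.2) 0
  have hc' : ∀ t l, c' (g (t, l)) = c t l := fun t l => hg.extend_apply _ _ (t, l)
  -- Division by the factorials makes the normalized coefficients equal to the values `c`;
  -- `Function.extend` gives zero to generators not hit by `g`.
  let C₀ : Coeffs k r j K n := fun q =>
    c' q.1 q.2 / ((∏ i, ((q.2 : Fin r →₀ ℕ) i).factorial : ℕ) : k)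
  have hC₀ : ∀ t l m, divCoeff m (familyForm C₀ (g (t, l))) =
      if m ∈ constrainedIdx r K j then c t l m else 0 := by
    intro t l m
    rw [divCoeff_apply, coeff_familyForm]
    split_ifs
    · simp only [C₀]
      rw [mul_div_cancel₀ _ (cast_prod_factorial_ne_zero m), hc']
    · rw [mul_zero]
  obtain ⟨Q, hQ0, hQ⟩ := exists_polynomial_of_mulVec_injective N C₀ (by
    intro x hx
    let x' : Fin v → (Fin r →₀ ℕ) → k := fun l b => if hb : b ∈ B then x (l, ⟨b, hb⟩) else 0
    have hx' : (fun κ : Fin v × B => x' κ.1 κ.2) = x := by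
      funext κ
      simp only [x', dif_pos κ.2.2]
    rw [← hx'] at hx ⊢
    funext κ
    refine hc x' (fun t a ha => ?_) κ.1 κ.2 κ.2.2
    have h1 := congrFun hx (t, ⟨a, ha⟩)
    rw [hmul] at h1
    refine Eq.trans ?_ h1
    refine Finset.sum_congr rfl fun l _ => Finset.sum_congr rfl fun b hb => ?_
    rw [hC₀, mul_ite, mul_zero]
    refine if_congr ?_ rfl rfl
    rw [hK, mem_boundedIdx]
    exact ⟨fun h => ⟨hdeg a ha b hb, h⟩, fun h => h.2⟩)
  refine ⟨Q, hQ0, fun C hC x hx l b hb => ?_⟩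
  have h1 := hQ C hC (fun κ => x κ.1 κ.2) (by
    funext ρ
    rw [hmul]
    exact hx ρ.1 ρ.2 ρ.2.2)
  exact congrFun h1 (l, ⟨b, hb⟩)

end Generic

/-! ### Upper and lower bounds for the Hilbert function. -/

section HilbertFunction

variable {k : Type*} [Field k]

theorem finrank_range_le_of_ker_le {V A Z : Type*} [AddCommGroup V] [Module k V]
    [AddCommGroup A] [Module k A] [AddCommGroup Z] [Module k Z] [FiniteDimensional k Z]
    (f : V →ₗ[k] A) (g : V →ₗ[k] Z) (h : LinearMap.ker g ≤ LinearMap.ker f) :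
    Module.finrank k (LinearMap.range f) ≤ Module.finrank k Z := by
  have e := g.quotKerEquivRange
  have : FiniteDimensional k (V ⧸ LinearMap.ker g) := e.symm.finiteDimensional
  have h1 : LinearMap.range f = LinearMap.range ((LinearMap.ker g).liftQ f h) :=
    (Submodule.range_liftQ _ _ _).symm
  rw [h1]
  refine (LinearMap.finrank_range_le _).trans ?_
  rw [e.finrank_eq]
  exact Submodule.finrank_le _

variable {r j n : ℕ} {K : List ℕ}

/-- No nonzero form of degree `d` in the bounded monomials annihilates the space with
coefficients `C`. -/
def AnnFree (C : Coeffs k r j K n) (I : Finset (Fin r)) (p : Fin r → ℕ) (d : ℕ) : Prop :=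
  ∀ F : MvPolynomial (Fin r) k, F.support ⊆ boundedIdx I p d → F ∈ annIdeal (spanFamily C) → F = 0

/-- The rows, indexed by `B` and the generators, of the catalecticant matrix with columns in `A`
are linearly independent. -/
def CatalecticantIndep (C : Coeffs k r j K n) (A B : Finset (Fin r →₀ ℕ)) : Prop :=
  ∀ x : Fin n → (Fin r →₀ ℕ) → k,
    (∀ D ∈ A, ∑ l, ∑ E ∈ B, x l E * divCoeff (D + E) (familyForm C l) = 0) →
    ∀ l, ∀ E ∈ B, x l E = 0

/-- Multiplication by the unbounded variable `X l` is injective and preserves both the bounds and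
the annihilator. -/
theorem AnnFree.of_succ {C : Coeffs k r j K n} {I : Finset (Fin r)} {p : Fin r → ℕ} {d : ℕ}
    {l : Fin r} (hl : l ∉ I) (h : AnnFree C I p (d + 1)) : AnnFree C I p d := by
  intro F hF hFC
  have h1 : X l * F = 0 := by
    refine h _ (fun D hD => ?_) (Ideal.mul_mem_left _ _ hFC)
    rw [support_X_mul, Finset.mem_map] at hD
    obtain ⟨D', hD', rfl⟩ := hD
    obtain ⟨h2, h3⟩ := mem_boundedIdx.1 (hF hD')
    rw [addLeftEmbedding_apply, mem_boundedIdx, map_add, Finsupp.degree_single, h2]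
    refine ⟨add_comm _ _, fun i hi => ?_⟩
    have hne : i ≠ l := fun h => hl (h ▸ hi)
    rw [Finsupp.add_apply, Finsupp.single_eq_of_ne hne, zero_add]
    exact h3 i hi
  exact (mul_eq_zero.1 h1).resolve_left (X_ne_zero l)

theorem AnnFree.of_le {C : Coeffs k r j K n} {I : Finset (Fin r)} {p : Fin r → ℕ} {d d' : ℕ}
    {l : Fin r} (hl : l ∉ I) (h : AnnFree C I p d') (hd : d ≤ d') : AnnFree C I p d := by
  obtain ⟨m, rfl⟩ := Nat.exists_eq_add_of_le hd
  clear hd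
  induction m with
  | zero => exact h
  | succ m ih => exact ih (AnnFree.of_succ hl h)

/-- A row relation in degree `d'` becomes one in degree `d` after multiplying its row monomials by
`x_l ^ (d' - d)`: in `D + E₀ + E` the factor `E₀` can be moved to the column side, where it keeps
the bounds of `J` and cannot repair a violated bound of `I`. -/
theorem CatalecticantIndep.of_le {C : Coeffs k r j K n} {I J : Finset (Fin r)}
    {p q : Fin r → ℕ} {l : Fin r} (hl : l ∉ J) {d d' : ℕ} (hdd' : d ≤ d') (hd' : d' ≤ j)
    (h : CatalecticantIndep C (boundedIdx J q d \ boundedIdx I p d) (boundedIdx J q (j - d))) :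
    CatalecticantIndep C (boundedIdx J q d' \ boundedIdx I p d') (boundedIdx J q (j - d')) := by
  classical
  intro x hx t E hE
  let E₀ : Fin r →₀ ℕ := Finsupp.single l (d' - d)
  have hE₀ : ∀ i, i ≠ l → E₀ i = 0 := fun i hi => Finsupp.single_eq_of_ne hi
  have hE₀deg : E₀.degree = d' - d := Finsupp.degree_single _ _
  have hE₀J : ∀ i ∈ J, E₀ i = 0 := fun i hi => hE₀ i fun h => hl (h ▸ hi)
  let y : Fin n → (Fin r →₀ ℕ) → k := fun t E' =>
    ∑ E ∈ boundedIdx J q (j - d'), if E + E₀ = E' then x t E else 0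
  have hmem : ∀ E ∈ boundedIdx J q (j - d'), E + E₀ ∈ boundedIdx J q (j - d) := by
    intro E hE
    obtain ⟨h1, h2⟩ := mem_boundedIdx.1 hE
    refine mem_boundedIdx.2 ⟨by rw [map_add, h1, hE₀deg]; omega, fun i hi => ?_⟩
    rw [Finsupp.add_apply, hE₀J i hi, add_zero]
    exact h2 i hi
  have hy := h y (by
    intro D hD
    obtain ⟨hDJ, hDI⟩ := Finset.mem_sdiff.1 hD
    rw [mem_boundedIdx] at hDJ hDI
    have hDA : D + E₀ ∈ boundedIdx J q d' \ boundedIdx I p d' := by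
      rw [Finset.mem_sdiff, mem_boundedIdx, mem_boundedIdx]
      refine ⟨⟨by rw [map_add, hDJ.1, hE₀deg]; omega, fun i hi => ?_⟩, fun hcon => hDI
        ⟨hDJ.1, fun i hi => ?_⟩⟩
      · rw [Finsupp.add_apply, hE₀J i hi, add_zero]
        exact hDJ.2 i hi
      · exact le_trans (by rw [Finsupp.add_apply]; exact Nat.le_add_right _ _) (hcon.2 i hi)
    refine Eq.trans ?_ (hx _ hDA)
    refine Finset.sum_congr rfl fun t _ => ?_
    simp only [y, Finset.sum_mul]
    rw [Finset.sum_comm]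
    refine Finset.sum_congr rfl fun E hE => ?_
    rw [Finset.sum_eq_single_of_mem _ (hmem E hE) (fun E' _ hne => by
      rw [if_neg (Ne.symm hne), zero_mul]), if_pos rfl, add_assoc, add_comm E₀]) t _ (hmem E hE)
  simp only [y] at hy
  rw [Finset.sum_eq_single_of_mem E hE (fun E' _ hne => if_neg fun h => hne (add_right_cancel h)),
    if_pos rfl] at hy
  exact hy

variable {s u : ℕ} {P Q : List ℕ} {I J : Finset (Fin r)} {p q : Fin r → ℕ}

/-- A derivative by a monomial that violates a bound kills every bounded monomial, since adding
exponents only increases them. -/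
theorem mem_annIdeal_spanFamily_of_coeff_eq_zero [CharZero k] {C : Coeffs k r j P s}
    (hP : constrainedIdx r P j = boundedIdx I p j) {d : ℕ} {F : MvPolynomial (Fin r) k}
    (hF : F.IsHomogeneous d) (h : ∀ D ∈ boundedIdx I p d, coeff D F = 0) :
    F ∈ annIdeal (spanFamily C) := by
  rw [spanFamily_eq, mem_annIdeal_span]
  intro t
  refine eq_zero_of_divCoeff fun E => ?_
  rw [divCoeff_diffOp subset_rfl]
  refine Finset.sum_eq_zero fun D hD => ?_
  rw [mem_support_iff] at hD
  have hdeg : D.degree = d := by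
    by_contra hne
    exact hD (hF.coeff_eq_zero hne)
  rw [divCoeff_familyForm_of_notMem, mul_zero]
  rw [hP, mem_boundedIdx]
  intro hcon
  exact hD (h D (mem_boundedIdx.2 ⟨hdeg, fun i hi =>
    le_trans (by rw [Finsupp.add_apply]; exact Nat.le_add_right _ _) (hcon.2 i hi)⟩))

theorem mem_annIdeal_spanFamily_of_divCoeff_eq_zero [CharZero k] {C : Coeffs k r j Q u}
    (hQ : constrainedIdx r Q j = boundedIdx J q j) {d : ℕ}
    {F : MvPolynomial (Fin r) k} (hF : F.IsHomogeneous d)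
    (h : ∀ t, ∀ E ∈ boundedIdx J q (j - d), divCoeff E (diffOp F (familyForm C t)) = 0) :
    F ∈ annIdeal (spanFamily C) := by
  rw [spanFamily_eq, mem_annIdeal_span]
  intro t
  refine eq_zero_of_divCoeff fun E => ?_
  by_cases hE : E ∈ boundedIdx J q (j - d)
  · exact h t E hE
  rw [divCoeff_diffOp subset_rfl]
  refine Finset.sum_eq_zero fun D hD => ?_
  rw [mem_support_iff] at hD
  have hdeg : D.degree = d := by
    by_contra hne
    exact hD (hF.coeff_eq_zero hne)
  rw [divCoeff_familyForm_of_notMem, mul_zero]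
  rw [hQ, mem_boundedIdx, map_add, hdeg]
  intro hcon
  exact hE (mem_boundedIdx.2 ⟨by omega, fun i hi =>
    le_trans (by rw [Finsupp.add_apply]; exact Nat.le_add_left _ _) (hcon.2 i hi)⟩)

/-- Valid for every choice of coefficients: `Θ` records the conditions that force a form into both
annihilators, and its target has the dimension on the right. -/
theorem hilbertFn_le [CharZero k] (C : Coeffs k r j P s) (C' : Coeffs k r j Q u)
    (hP : constrainedIdx r P j = boundedIdx I p j) (hQ : constrainedIdx r Q j = boundedIdx J q j)
    (d : ℕ) :
    hilbertFn (annIdeal (spanFamily C ⊔ spanFamily C')) d ≤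
      (boundedIdx I p d).card + u * (boundedIdx J q (j - d)).card := by
  let B := boundedIdx J q (j - d)
  let H := homogeneousSubmodule (Fin r) k d
  let Θ : H →ₗ[k] (boundedIdx I p d → k) × (Fin u × B → k) :=
    LinearMap.prod (LinearMap.pi fun D => (lcoeff k (D : Fin r →₀ ℕ)) ∘ₗ H.subtype)
      (LinearMap.pi fun κ => divCoeff (κ.2 : Fin r →₀ ℕ) ∘ₗ
        (LinearMap.applyₗ (familyForm C' κ.1)) ∘ₗ
          (diffOp : MvPolynomial (Fin r) k →ₐ[k] _).toLinearMap ∘ₗ H.subtype)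
  have h1 := finrank_range_le_of_ker_le
    ((Ideal.Quotient.mkₐ k (annIdeal (spanFamily C ⊔ spanFamily C'))).toLinearMap ∘ₗ H.subtype) Θ (by
      rintro ⟨F, hF⟩ hΘ
      have hΘ' : Θ ⟨F, hF⟩ = 0 := hΘ
      have e1 : ∀ D : boundedIdx I p d, coeff (D : Fin r →₀ ℕ) F = 0 := fun D =>
        congrFun (congrArg Prod.fst hΘ') D
      have e2 : ∀ κ : Fin u × B, divCoeff (κ.2 : Fin r →₀ ℕ) (diffOp F (familyForm C' κ.1)) = 0 :=
        fun κ => congrFun (congrArg Prod.snd hΘ') κ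
      refine Ideal.Quotient.eq_zero_iff_mem.2 (mem_annIdeal_sup.2 ⟨?_, ?_⟩)
      · exact mem_annIdeal_spanFamily_of_coeff_eq_zero hP hF fun D hD => e1 ⟨D, hD⟩
      · exact mem_annIdeal_spanFamily_of_divCoeff_eq_zero hQ hF fun t E hE => e2 (t, ⟨E, hE⟩))
  rw [LinearMap.range_comp, Submodule.range_subtype] at h1
  refine h1.trans (le_of_eq ?_)
  rw [Module.finrank_prod, Module.finrank_fintype_fun_eq_card, Module.finrank_fintype_fun_eq_card,
    Fintype.card_coe, Fintype.card_prod, Fintype.card_coe, Fintype.card_fin]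

/-- The polynomial with coefficients `z` at the monomials in `S`. -/
noncomputable def ofCoeffs (S : Finset (Fin r →₀ ℕ)) : (S → k) →ₗ[k] MvPolynomial (Fin r) k :=
  ∑ D : S, (monomial (D : Fin r →₀ ℕ)) ∘ₗ LinearMap.proj D

open scoped Classical in
theorem coeff_ofCoeffs (S : Finset (Fin r →₀ ℕ)) (z : S → k) (D : Fin r →₀ ℕ) :
    coeff D (ofCoeffs S z) = if h : D ∈ S then z ⟨D, h⟩ else 0 := by
  simp only [ofCoeffs, LinearMap.sum_apply, LinearMap.comp_apply, LinearMap.proj_apply, coeff_sum,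
    coeff_monomial]
  split_ifs with h
  · rw [Finset.sum_eq_single_of_mem ⟨D, h⟩ (Finset.mem_univ _)
      (fun D' _ hne => if_neg fun h' => hne (Subtype.ext h')), if_pos rfl]
  · refine Finset.sum_eq_zero fun D' _ => if_neg ?_
    rintro rfl
    exact h D'.2

theorem support_ofCoeffs_subset (S : Finset (Fin r →₀ ℕ)) (z : S → k) :
    (ofCoeffs S z).support ⊆ S := by
  classical
  intro D hD
  by_contra h
  rw [mem_support_iff, coeff_ofCoeffs, dif_neg h] at hD
  exact hD rfl

theorem ofCoeffs_isHomogeneous {S : Finset (Fin r →₀ ℕ)} {d : ℕ} (hS : ∀ D ∈ S, D.degree = d)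
    (z : S → k) : (ofCoeffs S z).IsHomogeneous d := by
  simp only [ofCoeffs, LinearMap.sum_apply, LinearMap.comp_apply, LinearMap.proj_apply]
  exact IsHomogeneous.sum _ _ _ fun D _ => isHomogeneous_monomial _ (hS D D.2)

theorem ofCoeffs_single [DecidableEq (Fin r →₀ ℕ)] (S : Finset (Fin r →₀ ℕ)) (D : S) :
    ofCoeffs S (Pi.single D (1 : k)) = monomial (D : Fin r →₀ ℕ) 1 := by
  classical
  ext D'
  rw [coeff_ofCoeffs, coeff_monomial]
  by_cases h : (D : Fin r →₀ ℕ) = D'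
  · subst h
    rw [dif_pos D.2, Pi.single_eq_same, if_pos rfl]
  · rw [if_neg h]
    split_ifs with h'
    · rw [Pi.single_eq_of_ne]
      exact fun h'' => h (congrArg Subtype.val h'').symm
    · rfl

instance finiteDimensional_homogeneousSubmodule (d : ℕ) :
    FiniteDimensional k (homogeneousSubmodule (Fin r) k d) := by
  classical
  refine Submodule.finiteDimensional_of_le (S₂ := LinearMap.range
    (ofCoeffs (k := k) (Finset.finsuppAntidiag (Finset.univ : Finset (Fin r)) d)))
    fun F hF => ⟨fun D => coeff D F, ?_⟩
  ext D
  rw [coeff_ofCoeffs]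
  split_ifs with h
  · rfl
  · refine (IsHomogeneous.coeff_eq_zero hF fun hdeg => h ?_).symm
    rw [Finset.mem_finsuppAntidiag, ← hdeg, Finsupp.degree_eq_sum]
    exact ⟨rfl, Finset.subset_univ _⟩

/-- The catalecticant map of the generators with coefficients `C`, on the forms supported in `A`,
recording the coefficients at `B`. -/
noncomputable def catalecticantMap (C : Coeffs k r j K n) (A B : Finset (Fin r →₀ ℕ)) :
    (A → k) →ₗ[k] (Fin n × B → k) :=
  LinearMap.pi fun κ => divCoeff (κ.2 : Fin r →₀ ℕ) ∘ₗ (LinearMap.applyₗ (familyForm C κ.1)) ∘ₗ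
    (diffOp : MvPolynomial (Fin r) k →ₐ[k] _).toLinearMap ∘ₗ ofCoeffs A

theorem catalecticantMap_apply (C : Coeffs k r j K n) (A B : Finset (Fin r →₀ ℕ)) (z : A → k)
    (κ : Fin n × B) : catalecticantMap C A B z κ =
      divCoeff (κ.2 : Fin r →₀ ℕ) (diffOp (ofCoeffs A z) (familyForm C κ.1)) := rfl

/-- A functional vanishing on the image is a linear relation between the rows, so surjectivity is
dual to their independence. -/
theorem catalecticantMap_surjective {C : Coeffs k r j K n} {A B : Finset (Fin r →₀ ℕ)}
    (hC : CatalecticantIndep C A B) : Function.Surjective (catalecticantMap C A B) := by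
  classical
  rw [← LinearMap.dualMap_injective_iff, ← LinearMap.ker_eq_bot, LinearMap.ker_eq_bot']
  intro φ hφ
  have h1 := hC (fun l E => if hE : E ∈ B then φ (Pi.single (l, ⟨E, hE⟩) 1) else 0) (by
    intro D hD
    have h2 : φ (catalecticantMap C A B (Pi.single ⟨D, hD⟩ 1)) = 0 := LinearMap.congr_fun hφ _
    have h4 : catalecticantMap C A B (Pi.single ⟨D, hD⟩ 1) = ∑ κ : Fin n × B,
        divCoeff (D + κ.2 : Fin r →₀ ℕ) (familyForm C κ.1) • Pi.single κ (1 : k) := by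
      funext κ
      rw [catalecticantMap_apply, ofCoeffs_single, divCoeff_diffOp_monomial, one_mul,
        Finset.sum_apply, Finset.sum_eq_single_of_mem κ (Finset.mem_univ _)]
      · rw [Pi.smul_apply, Pi.single_eq_same, smul_eq_mul, mul_one]
      · intro κ' _ hne
        rw [Pi.smul_apply, Pi.single_eq_of_ne (Ne.symm hne), smul_zero]
    rw [h4, map_sum, Fintype.sum_prod_type] at h2
    refine Eq.trans ?_ h2
    refine Finset.sum_congr rfl fun l _ => ?_
    rw [← Finset.sum_coe_sort]
    refine Finset.sum_congr rfl fun E _ => ?_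
    rw [dif_pos E.2, map_smul, smul_eq_mul, mul_comm])
  refine LinearMap.pi_ext' fun κ => LinearMap.ext_ring ?_
  have h2 := h1 κ.1 κ.2 κ.2.2
  rw [dif_pos κ.2.2] at h2
  exact h2

/-- Forms supported on `A` avoid the `P`-bounded monomials and so kill `ℰ` for free. A section of
the catalecticant map of `ℱ` on such forms gives `u · m_Q(j-d)` dimensions independent of those
detected by `ℰ`. -/
theorem le_hilbertFn [CharZero k] (C : Coeffs k r j P s) (C' : Coeffs k r j Q u)
    (hP : constrainedIdx r P j = boundedIdx I p j) {d : ℕ} (hC : AnnFree C I p d)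
    (hC' : CatalecticantIndep C' (boundedIdx J q d \ boundedIdx I p d) (boundedIdx J q (j - d))) :
    (boundedIdx I p d).card + u * (boundedIdx J q (j - d)).card ≤
      hilbertFn (annIdeal (spanFamily C ⊔ spanFamily C')) d := by
  classical
  generalize hA : boundedIdx J q d \ boundedIdx I p d = A at hC'
  generalize boundedIdx J q (j - d) = B at hC' ⊢
  have hAdeg : ∀ D ∈ A, D.degree = d := fun D hD =>
    (mem_boundedIdx.1 (Finset.mem_sdiff.1 (hA ▸ hD)).1).1
  have hAI : ∀ D ∈ boundedIdx I p d, D ∉ A := fun D hD h =>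
    (Finset.mem_sdiff.1 (hA ▸ h)).2 hD
  have hIdeg : ∀ D ∈ boundedIdx I p d, D.degree = d := fun D hD => (mem_boundedIdx.1 hD).1
  obtain ⟨σ, hσ⟩ := LinearMap.exists_rightInverse_of_surjective (catalecticantMap C' A B)
    (LinearMap.range_eq_top.2 (catalecticantMap_surjective hC'))
  have hσ' : ∀ y, catalecticantMap C' A B (σ y) = y := fun y => LinearMap.congr_fun hσ y
  let T : (boundedIdx I p d → k) × (Fin u × B → k) →ₗ[k] MvPolynomial (Fin r) k :=
    ofCoeffs (boundedIdx I p d) ∘ₗ LinearMap.fst k _ _ + (ofCoeffs A ∘ₗ σ) ∘ₗ LinearMap.snd k _ _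
  have hT : ∀ x y, T (x, y) = ofCoeffs (boundedIdx I p d) x + ofCoeffs A (σ y) := fun x y => rfl
  have hThom : ∀ v, (T v).IsHomogeneous d := fun v =>
    (ofCoeffs_isHomogeneous hIdeg _).add (ofCoeffs_isHomogeneous hAdeg _)
  -- The system is triangular: `ℰ` sees only the first summand and forces it to vanish; then `ℱ`
  -- sees only the second.
  have hTinj : ∀ v, T v ∈ annIdeal (spanFamily C ⊔ spanFamily C') → v = 0 := by
    rintro ⟨x, y⟩ hv
    obtain ⟨hv1, hv2⟩ := mem_annIdeal_sup.1 hv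
    have e1 : ofCoeffs A (σ y) ∈ annIdeal (spanFamily C) :=
      mem_annIdeal_spanFamily_of_coeff_eq_zero hP (ofCoeffs_isHomogeneous hAdeg _) fun D hD => by
        rw [coeff_ofCoeffs, dif_neg (hAI D hD)]
    have e2 : ofCoeffs (boundedIdx I p d) x = 0 := by
      refine hC _ (support_ofCoeffs_subset _ _) ?_
      rw [hT] at hv1
      exact (Ideal.add_mem_iff_left _ e1).1 hv1
    rw [hT, e2, zero_add, spanFamily_eq, mem_annIdeal_span] at hv2
    have e3 : y = 0 := by
      rw [← hσ' y]
      funext κ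
      rw [catalecticantMap_apply, hv2, map_zero, Pi.zero_apply]
    have e4 : x = 0 := by
      funext D
      have h := congrArg (coeff (D : Fin r →₀ ℕ)) e2
      rw [coeff_ofCoeffs, dif_pos D.2, coeff_zero] at h
      exact h
    rw [e3, e4, Prod.mk_zero_zero]
  let T' : (boundedIdx I p d → k) × (Fin u × B → k) →ₗ[k]
      gradedPiece (annIdeal (spanFamily C ⊔ spanFamily C')) d :=
    LinearMap.codRestrict _ ((Ideal.Quotient.mkₐ k _).toLinearMap ∘ₗ T)
      fun v => mem_gradedPiece.2 ⟨T v, hThom v, rfl⟩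
  have hT'inj : Function.Injective T' := by
    rw [← LinearMap.ker_eq_bot, LinearMap.ker_eq_bot']
    intro v hv
    exact hTinj v (Ideal.Quotient.eq_zero_iff_mem.1 (congrArg Subtype.val hv))
  have hfin : FiniteDimensional k (gradedPiece (annIdeal (spanFamily C ⊔ spanFamily C')) d) := by
    unfold gradedPiece
    infer_instance
  have h5 := LinearMap.finrank_le_finrank_of_injective hT'inj
  rwa [Module.finrank_prod, Module.finrank_fintype_fun_eq_card, Module.finrank_fintype_fun_eq_card,
    Fintype.card_coe, Fintype.card_prod, Fintype.card_coe, Fintype.card_fin] at h5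

end HilbertFunction

/-! ### General members: directness, levelness, codimension and attained bounds. -/

section General

variable {k : Type*} [Field k] {r j s u : ℕ} {P Q : List ℕ} {I J : Finset (Fin r)}
  {p q : Fin r → ℕ}

theorem card_fiber_boundedIdx_antitone {l : Fin r} (hl : l ∉ I) (d : ℕ) (α β : Fin r → ℕ)
    (hαβ : α ≤ β) :
    ((boundedIdx I p d).filter fun D => idxClass I D = β).card ≤
      ((boundedIdx I p d).filter fun D => idxClass I D = α).card :=
  card_fiber_antitone hl (fun _ hD => (mem_boundedIdx.1 hD).1)
    (fun _ hD _ hdeg hle _ _ => mem_boundedIdx.2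
      ⟨hdeg, fun i hi => (hle i hi).trans ((mem_boundedIdx.1 hD).2 i hi)⟩) α β hαβ

/-- Disjointness of `I` and `J` is essential: lowering exponents in `J` in favour of `x_l` never
lowers an exponent in `I`, so a violated bound of `I` stays violated. -/
theorem card_fiber_boundedIdx_sdiff_antitone (hIJ : Disjoint I J) {l : Fin r} (hl : l ∉ J) (d : ℕ)
    (α β : Fin r → ℕ) (hαβ : α ≤ β) :
    ((boundedIdx J q d \ boundedIdx I p d).filter fun D => idxClass J D = β).card ≤
      ((boundedIdx J q d \ boundedIdx I p d).filter fun D => idxClass J D = α).card := by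
  refine card_fiber_antitone hl (fun _ hD => (mem_boundedIdx.1 (Finset.mem_sdiff.1 hD).1).1)
    (fun D hD D' hdeg hle heq hl' => ?_) α β hαβ
  obtain ⟨h1, h2⟩ := Finset.mem_sdiff.1 hD
  rw [mem_boundedIdx] at h1 h2
  refine Finset.mem_sdiff.2 ⟨mem_boundedIdx.2 ⟨hdeg, fun i hi => (hle i hi).trans (h1.2 i hi)⟩,
    fun hcon => h2 ⟨h1.1, fun i hi => ?_⟩⟩
  refine le_trans ?_ ((mem_boundedIdx.1 hcon).2 i hi)
  by_cases h : i = l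
  · rw [h]
    exact hl'
  · exact (heq i (Finset.disjoint_left.1 hIJ hi) h).ge

theorem exists_polynomial_annFree [CharZero k] (hP : constrainedIdx r P j = boundedIdx I p j) {l : Fin r}
    (hl : l ∉ I) {d : ℕ} (hd : d ≤ j)
    (hs : (boundedIdx I p d).card ≤ s * (boundedIdx I p (j - d)).card) :
    ∃ T : MvPolynomial (Fin s × {J // J ∈ constrainedIdx r P j}) k, T ≠ 0 ∧
      ∀ C : Coeffs k r j P s, eval C T ≠ 0 → AnnFree C I p d := by
  obtain ⟨T, hT0, hT⟩ := exists_generic_nondegenerate (k := k) (s := s) (v := 1) Prod.fst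
    (fun x y h => Prod.ext h (Subsingleton.elim _ _)) I p hP (boundedIdx I p (j - d))
    (boundedIdx I p d)
    (fun a ha b hb => by
      rw [map_add, (mem_boundedIdx.1 ha).1, (mem_boundedIdx.1 hb).1]
      omega)
    (fun a ha => idxClass_le_iff.2 (mem_boundedIdx.1 ha).2)
    (fun a ha => idxClass_le_iff.2 (mem_boundedIdx.1 ha).2)
    (fun α β h _ => card_fiber_boundedIdx_antitone hl _ α β h)
    (fun α β h _ => card_fiber_boundedIdx_antitone hl _ α β h)
    (by rwa [one_mul])
  refine ⟨T, hT0, fun C hC F hF hFC => ?_⟩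
  rw [spanFamily_eq, mem_annIdeal_span] at hFC
  have h1 := hT C hC (fun _ D => coeff D F) (fun t a _ => by
    rw [Fin.sum_univ_one]
    have h2 := congrArg (divCoeff a) (hFC t)
    rw [divCoeff_diffOp hF, map_zero] at h2
    refine Eq.trans (Finset.sum_congr rfl fun D _ => ?_) h2
    rw [add_comm]) 0
  ext D
  rw [coeff_zero]
  by_cases hD : D ∈ F.support
  · exact h1 D (hF hD)
  · exact notMem_support_iff.1 hD

theorem exists_polynomial_catalecticantIndep [CharZero k] (hQ : constrainedIdx r Q j = boundedIdx J q j)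
    (hIJ : Disjoint I J) {l : Fin r} (hl : l ∉ J) {d : ℕ} (hd : d ≤ j)
    (hu : u * (boundedIdx J q (j - d)).card ≤ (boundedIdx J q d \ boundedIdx I p d).card) :
    ∃ T : MvPolynomial (Fin u × {D // D ∈ constrainedIdx r Q j}) k, T ≠ 0 ∧
      ∀ C : Coeffs k r j Q u, eval C T ≠ 0 →
        CatalecticantIndep C (boundedIdx J q d \ boundedIdx I p d) (boundedIdx J q (j - d)) := by
  have hmem : ∀ D ∈ boundedIdx J q d \ boundedIdx I p d, D.degree = d ∧ ∀ i ∈ J, D i ≤ q i :=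
    fun D hD => mem_boundedIdx.1 (Finset.mem_sdiff.1 hD).1
  obtain ⟨T, hT0, hT⟩ := exists_generic_nondegenerate (k := k) (s := 1) (v := u) Prod.snd
    (fun x y h => Prod.ext (Subsingleton.elim _ _) h) J q hQ
    (boundedIdx J q d \ boundedIdx I p d) (boundedIdx J q (j - d))
    (fun a ha b hb => by
      rw [map_add, (hmem a ha).1, (mem_boundedIdx.1 hb).1]
      omega)
    (fun a ha => idxClass_le_iff.2 (hmem a ha).2)
    (fun a ha => idxClass_le_iff.2 (mem_boundedIdx.1 ha).2)
    (fun α β h _ => card_fiber_boundedIdx_sdiff_antitone hIJ hl _ α β h)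
    (fun α β h _ => card_fiber_boundedIdx_antitone hl _ α β h)
    (by rwa [one_mul])
  exact ⟨T, hT0, fun C hC x hx => hT C hC x fun _ => hx⟩

theorem isHomogeneous_of_mem_spanFamily {C : Coeffs k r j P s} {w : MvPolynomial (Fin r) k}
    (hw : w ∈ spanFamily C) : w.IsHomogeneous j := by
  have h : spanFamily C ≤ homogeneousSubmodule (Fin r) k j := by
    rw [spanFamily_eq, Submodule.span_le]
    rintro _ ⟨t, rfl⟩
    exact familyForm_isHomogeneous C t
  exact h hw

theorem divCoeff_eq_zero_of_mem_spanFamily {C : Coeffs k r j P s} {w : MvPolynomial (Fin r) k}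
    (hw : w ∈ spanFamily C) {D : Fin r →₀ ℕ} (hD : D ∉ constrainedIdx r P j) :
    divCoeff D w = 0 := by
  have h : spanFamily C ≤ LinearMap.ker (divCoeff D) := by
    rw [spanFamily_eq, Submodule.span_le]
    rintro _ ⟨t, rfl⟩
    exact divCoeff_familyForm_of_notMem C t hD
  exact h hw

/-- In degree `j` the only row index is `0`, so the catalecticant condition says that the generators
of `ℱ` stay independent after discarding `P`-bounded monomials, whereas elements of `ℰ` have no
others. -/
theorem disjoint_spanFamily {C : Coeffs k r j P s} {C' : Coeffs k r j Q u}
    (hP : constrainedIdx r P j = boundedIdx I p j)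
    (hC' : CatalecticantIndep C' (boundedIdx J q j \ boundedIdx I p j) (boundedIdx J q 0)) :
    Disjoint (spanFamily C) (spanFamily C') := by
  rw [Submodule.disjoint_def]
  intro w hw hw'
  rw [spanFamily_eq] at hw'
  obtain ⟨x, rfl⟩ := (Submodule.mem_span_range_iff_exists_fun k).1 hw'
  have h0 : boundedIdx J q 0 = {0} := by
    ext E
    rw [mem_boundedIdx, Finset.mem_singleton, Finsupp.degree_eq_zero_iff]
    refine ⟨fun h => h.1, ?_⟩
    rintro rfl
    exact ⟨rfl, fun i _ => Nat.zero_le _⟩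
  have h1 := hC' (fun t _ => x t) (fun D hD => by
    have h2 := divCoeff_eq_zero_of_mem_spanFamily hw (D := D)
      (by rw [hP]; exact (Finset.mem_sdiff.1 hD).2)
    rw [map_sum] at h2
    refine Eq.trans (Finset.sum_congr rfl fun t _ => ?_) h2
    rw [h0, Finset.sum_singleton, add_zero, map_smul, smul_eq_mul])
  refine Finset.sum_eq_zero fun t _ => ?_
  rw [h1 t 0 (by rw [h0, Finset.mem_singleton]), zero_smul]

/-- With all bounds at least `1`, every monomial of degree at most `1` is bounded, so freeness in
degree `1` covers all linear forms. -/
theorem AnnFree.hasFullCodim {C : Coeffs k r j P s} {l : Fin r} (hl : l ∉ I)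
    (hp : ∀ i ∈ I, 1 ≤ p i) (hC : AnnFree C I p 1) (W : Submodule k (MvPolynomial (Fin r) k)) :
    HasFullCodim (annIdeal (spanFamily C ⊔ W)) := by
  have key : ∀ d ≤ 1, ∀ F ∈ annIdeal (spanFamily C ⊔ W), F.IsHomogeneous d → F = 0 := by
    intro d hd F hF hFd
    refine hC.of_le hl hd F (fun D hD => mem_boundedIdx.2 ?_) (mem_annIdeal_sup.1 hF).1
    have hdeg : D.degree = d := by
      by_contra hne
      exact (mem_support_iff.1 hD) (hFd.coeff_eq_zero hne)
    exact ⟨hdeg, fun i hi => ((Finsupp.le_degree i D).trans (hdeg.trans_le hd)).trans (hp i hi)⟩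
  rintro F hF (h | h)
  · exact key 0 zero_le_one F hF h
  · exact key 1 le_rfl F hF h

/-- Reduces everything to counting. Sufficiency of `s` is used in degree `iF` and `hu` in degree
`i`; the two transfer lemmas then make the upper bound exact in both degrees. -/
theorem generallyNonUnimodal_of [CharZero k] {iF : ℕ}
    (hP : ∀ d ≤ j, constrainedIdx r P d = boundedIdx I p d)
    (hQ : constrainedIdx r Q j = boundedIdx J q j)
    {l l' : Fin r} (hl : l ∉ I) (hl' : l' ∉ J) (hIJ : Disjoint I J) (hp : ∀ i ∈ I, 1 ≤ p i)
    {i : ℕ} (hi : i ≤ iF) (hiF : 1 ≤ iF) (hj : iF ≤ j)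
    (hs : (FamilyData.mk r j P Q s u iF).Sufficient)
    (hu : u * (boundedIdx J q (j - i)).card ≤ (boundedIdx J q i \ boundedIdx I p i).card)
    {drop : (ℕ → ℕ) → Prop}
    (hdrop : ∀ h : ℕ → ℕ,
      (∀ d ≤ j, h d ≤ (boundedIdx I p d).card + u * (boundedIdx J q (j - d)).card) →
      h i = (boundedIdx I p i).card + u * (boundedIdx J q (j - i)).card →
      h iF = (boundedIdx I p iF).card + u * (boundedIdx J q (j - iF)).card →
      ¬ IsUnimodal h j ∧ drop h) :
    (FamilyData.mk r j P Q s u iF).GenerallyNonUnimodal k drop := by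
  have hPj := hP j le_rfl
  have hs' : (boundedIdx I p iF).card ≤ s * (boundedIdx I p (j - iF)).card := by
    have h : Fintype.card {D // D ∈ constrainedIdx r P (j - (j - iF))} ≤
      Fintype.card ({E // E ∈ constrainedIdx r P (j - iF)} × Fin s) := hs
    rw [Fintype.card_prod, Fintype.card_coe, Fintype.card_coe, Fintype.card_fin,
      Nat.sub_sub_self hj, hP _ hj, hP _ (Nat.sub_le _ _), mul_comm] at h
    exact h
  obtain ⟨T, hT0, hT⟩ := exists_polynomial_annFree (k := k) hPj hl hj hs'
  obtain ⟨T', hT'0, hT'⟩ :=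
    exists_polynomial_catalecticantIndep (k := k) hQ hIJ hl' (hi.trans hj) hu
  refine ⟨_, _, isZariskiOpen_ne_zero T, isZariskiDense_ne_zero hT0, isZariskiOpen_ne_zero T',
    isZariskiDense_ne_zero hT'0, fun C hC C' hC' => ?_⟩
  have hE := hT C hC
  have hF := hT' C' hC'
  have hcod := (hE.of_le hl hiF).hasFullCodim hl hp (spanFamily C')
  refine ⟨?_, isLevel_annIdeal (fun w hw => ?_) ?_, hcod, ?_⟩
  · have := hF.of_le hl' (hi.trans hj) le_rfl
    rw [Nat.sub_self] at this
    exact disjoint_spanFamily hPj this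
  · obtain ⟨w₁, h₁, w₂, h₂, rfl⟩ := Submodule.mem_sup.1 hw
    exact (isHomogeneous_of_mem_spanFamily h₁).add (isHomogeneous_of_mem_spanFamily h₂)
  -- If the space were zero its annihilator would contain `1`, contrary to full codimension.
  · intro hbot
    refine one_ne_zero (hcod 1 ?_ (Or.inl (isHomogeneous_one _ _)))
    rw [hbot, mem_annIdeal]
    intro f hf
    rw [(Submodule.mem_bot k).1 hf, map_zero]
  · refine hdrop _ (fun d _ => hilbertFn_le C C' hPj hQ d) (le_antisymm (hilbertFn_le C C' hPj hQ _)
      (le_hilbertFn C C' hPj (hE.of_le hl hi) hF)) (le_antisymm (hilbertFn_le C C' hPj hQ _)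
      (le_hilbertFn C C' hPj hE (hF.of_le hl' hi hj)))

end General

/-! ### Counting bounded monomials. -/

section Counting

variable {r : ℕ} {I J : Finset (Fin r)} {p q : Fin r → ℕ}

theorem boundedIdx_congr (h : ∀ i ∈ I, p i = q i) (d : ℕ) : boundedIdx I p d = boundedIdx I q d := by
  ext D
  rw [mem_boundedIdx, mem_boundedIdx]
  exact and_congr_right fun _ => forall₂_congr fun i hi => by rw [h i hi]

theorem constrainedIdx_eq_boundedIdx {K : List ℕ} {d : ℕ}
    (h : ∀ (i : Fin r) (x : ℕ), x ≤ d →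
      ((∀ hi : (i : ℕ) < K.length, x ≤ K[(i : ℕ)]) ↔ (i ∈ I → x ≤ p i))) :
    constrainedIdx r K d = boundedIdx I p d := by
  refine Finset.filter_congr fun D hD => forall_congr' fun i => h i _ ?_
  rw [Finset.mem_finsuppAntidiag] at hD
  rw [← hD.1]
  exact Finset.single_le_sum (f := fun i => D i) (fun _ _ => Nat.zero_le _) (Finset.mem_univ i)

/-- Monomials are split by divisibility by the free variable `x_l`; those not divisible are counted
by making `l` a position with bound `0`, whence the normalization `p l = 0`. -/
theorem card_boundedIdx_succ {l : Fin r} (hl : l ∉ I) (hpl : p l = 0) (d : ℕ) :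
    (boundedIdx I p (d + 1)).card =
      (boundedIdx I p d).card + (boundedIdx (insert l I) p (d + 1)).card := by
  classical
  rw [← Finset.card_filter_add_card_filter_not (s := boundedIdx I p (d + 1)) (fun D => D l = 0),
    add_comm]
  congr 1
  · have h : (boundedIdx I p (d + 1)).filter (fun D => ¬ D l = 0) =
        (boundedIdx I p d).map (addRightEmbedding (Finsupp.single l 1)) := by
      ext D
      rw [Finset.mem_filter, Finset.mem_map, mem_boundedIdx]
      constructor
      · rintro ⟨⟨h1, h2⟩, h3⟩
        have h4 : D - Finsupp.single l 1 + Finsupp.single l 1 = D :=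
          tsub_add_cancel_of_le (Finsupp.single_le_iff.2 (Nat.one_le_iff_ne_zero.2 h3))
        refine ⟨D - Finsupp.single l 1, mem_boundedIdx.2 ⟨?_, fun i hi => ?_⟩, h4⟩
        · have := congrArg Finsupp.degree h4
          rw [map_add, Finsupp.degree_single, h1] at this
          omega
        · rw [Finsupp.tsub_apply]
          exact (Nat.sub_le _ _).trans (h2 i hi)
      · rintro ⟨D, hD, rfl⟩
        rw [mem_boundedIdx] at hD
        rw [addRightEmbedding_apply, map_add, Finsupp.degree_single, hD.1]
        refine ⟨⟨rfl, fun i hi => ?_⟩, ?_⟩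
        · have hne : i ≠ l := fun h => hl (h ▸ hi)
          rw [Finsupp.add_apply, Finsupp.single_eq_of_ne hne, add_zero]
          exact hD.2 i hi
        · rw [Finsupp.add_apply, Finsupp.single_eq_same]
          exact Nat.succ_ne_zero _
    rw [h, Finset.card_map]
  · congr 1
    ext D
    rw [Finset.mem_filter, mem_boundedIdx, mem_boundedIdx, Finset.forall_mem_insert, hpl,
      Nat.le_zero]
    tauto

theorem card_boundedIdx_le {l : Fin r} (hI : I = Finset.univ.erase l) (d : ℕ) :
    (boundedIdx I p d).card ≤ ∏ i ∈ I, (p i + 1) := by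
  classical
  have h1 : (Fintype.piFinset fun i => if i ∈ I then Finset.range (p i + 1) else {0}).card =
      ∏ i ∈ I, (p i + 1) := by
    rw [Fintype.card_piFinset, ← Finset.prod_subset (Finset.subset_univ I)]
    · refine Finset.prod_congr rfl fun i hi => ?_
      rw [if_pos hi, Finset.card_range]
    · intro i _ hi
      rw [if_neg hi, Finset.card_singleton]
  rw [← h1]
  have hl : l ∉ I := by rw [hI]; exact Finset.notMem_erase _ _
  have hI' : ∀ i, i ∉ I → i = l := fun i hi => by
    by_contra h
    exact hi (by rw [hI]; exact Finset.mem_erase.2 ⟨h, Finset.mem_univ _⟩)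
  refine Finset.card_le_card_of_injOn (fun D i => if i ∈ I then D i else 0) (fun D hD => ?_)
    fun D hD D' hD' h => ?_
  · rw [Finset.mem_coe, mem_boundedIdx] at hD
    rw [Finset.mem_coe, Fintype.mem_piFinset]
    intro i
    dsimp only
    split_ifs with hi
    · exact Finset.mem_range.2 (Nat.lt_succ_of_le (hD.2 i hi))
    · exact Finset.mem_singleton_self _
  · rw [Finset.mem_coe, mem_boundedIdx, Finsupp.degree_eq_sum,
      ← Finset.add_sum_erase _ _ (Finset.mem_univ l), ← hI] at hD hD'
    have h2 : ∀ i ∈ I, D i = D' i := fun i hi => by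
      have := congrFun h i
      simp only [if_pos hi] at this
      exact this
    have h3 : ∑ i ∈ I, D i = ∑ i ∈ I, D' i := Finset.sum_congr rfl h2
    ext i
    by_cases hi : i ∈ I
    · exact h2 i hi
    · rw [hI' i hi]
      omega

/-- With one free variable, its exponent is determined by the others, which are arbitrary within
their bounds once `d` is large enough. -/
theorem card_boundedIdx_eq {l : Fin r} (hI : I = Finset.univ.erase l) {d : ℕ}
    (hd : ∑ i ∈ I, p i ≤ d) : (boundedIdx I p d).card = ∏ i ∈ I, (p i + 1) := by
  classical
  refine le_antisymm (card_boundedIdx_le hI d) ?_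
  have h1 : (I.pi fun i => Finset.range (p i + 1)).card = ∏ i ∈ I, (p i + 1) := by
    rw [Finset.card_pi]
    exact Finset.prod_congr rfl fun i _ => Finset.card_range _
  have hl : l ∉ I := by rw [hI]; exact Finset.notMem_erase _ _
  rw [← h1]
  let ext : (∀ i ∈ I, ℕ) → Fin r → ℕ := fun α i => if h : i ∈ I then α i h else 0
  let tot : (∀ i ∈ I, ℕ) → ℕ := fun α => ∑ i ∈ I, ext α i
  let f : (∀ i ∈ I, ℕ) → (Fin r →₀ ℕ) := fun α =>
    Finsupp.equivFunOnFinite.symm fun i => if i ∈ I then ext α i else d - tot α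
  have hf : ∀ α i, f α i = if i ∈ I then ext α i else d - tot α := fun α i => rfl
  refine Finset.card_le_card_of_injOn f (fun α hα => ?_) fun α hα β hβ h => ?_
  · rw [Finset.mem_coe, Finset.mem_pi] at hα
    have h2 : ∀ i ∈ I, ext α i ≤ p i := fun i hi => by
      have := Finset.mem_range.1 (hα i hi)
      simp only [ext, dif_pos hi]
      omega
    have h3 : tot α ≤ d := (Finset.sum_le_sum h2).trans hd
    rw [Finset.mem_coe, mem_boundedIdx, Finsupp.degree_eq_sum,
      ← Finset.add_sum_erase _ _ (Finset.mem_univ l), ← hI, hf, if_neg hl]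
    refine ⟨?_, fun i hi => by rw [hf, if_pos hi]; exact h2 i hi⟩
    have h4 : ∑ i ∈ I, f α i = tot α := Finset.sum_congr rfl fun i hi => by rw [hf, if_pos hi]
    omega
  · funext i hi
    have h2 := DFunLike.congr_fun h i
    rw [hf, hf, if_pos hi, if_pos hi] at h2
    simp only [ext, dif_pos hi] at h2
    exact h2

theorem card_boundedIdx_degree_zero : (boundedIdx I p 0).card = 1 := by
  rw [Finset.card_eq_one]
  refine ⟨0, ?_⟩
  ext D
  rw [mem_boundedIdx, Finset.mem_singleton, Finsupp.degree_eq_zero_iff]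
  refine ⟨fun h => h.1, ?_⟩
  rintro rfl
  exact ⟨rfl, fun i _ => Nat.zero_le _⟩

theorem card_boundedIdx_zero_left (hp : ∀ i ∈ I, p i = 0) (d : ℕ) :
    (boundedIdx I p d).card = Nat.multichoose (Iᶜ).card d := by
  rw [boundedIdx_congr (q := 0) hp]
  clear hp
  induction d generalizing I with
  | zero => rw [Nat.multichoose_zero_right, card_boundedIdx_degree_zero]
  | succ d ih =>
    generalize hn : (Iᶜ).card = n
    induction n generalizing I with
    | zero =>
      rw [Nat.multichoose_zero_succ, Finset.card_eq_zero, Finset.eq_empty_iff_forall_notMem]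
      intro D hD
      rw [mem_boundedIdx] at hD
      rw [Finset.card_eq_zero, Finset.compl_eq_empty_iff] at hn
      have h : D = 0 := by
        ext i
        exact Nat.le_zero.1 (hD.2 i (hn ▸ Finset.mem_univ i))
      rw [h, map_zero] at hD
      omega
    | succ n ihn =>
      obtain ⟨l, hl⟩ : (Iᶜ).Nonempty := Finset.card_pos.1 (by omega)
      rw [Finset.mem_compl] at hl
      rw [card_boundedIdx_succ hl rfl, ih, hn, ihn, Nat.multichoose_succ_succ, add_comm]
      rw [Finset.compl_insert, Finset.card_erase_of_mem (Finset.mem_compl.2 hl)]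
      omega

theorem multichoose_three_succ (d : ℕ) :
    Nat.multichoose 3 (d + 1) = Nat.multichoose 3 d + (d + 2) := by
  rw [Nat.multichoose_succ_succ, Nat.multichoose_two]
  exact Nat.add_comm _ _

theorem multichoose_mono (n : ℕ) : Monotone (Nat.multichoose (n + 1)) :=
  monotone_nat_of_le_succ fun d => by
    rw [Nat.multichoose_succ_succ]
    exact Nat.le_add_left _ _

theorem two_mul_multichoose_three (e : ℕ) : 2 * Nat.multichoose 3 e = (e + 1) * (e + 2) := by
  induction e with
  | zero => simp
  | succ e ih =>
    rw [multichoose_three_succ, mul_add, ih]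
    ring

/-- Multiplication by `x_l ^ m` with `m > p l` sends every monomial of degree `d - m` to one
violating the bound at `l`. -/
theorem multichoose_le_card_boundedIdx_sdiff {l : Fin r} (hl : l ∈ I) {d m : ℕ} (hm : p l < m)
    (hd : m ≤ d) :
    Nat.multichoose r (d - m) ≤ (boundedIdx ∅ q d \ boundedIdx I p d).card := by
  have h := card_boundedIdx_zero_left (I := (∅ : Finset (Fin r))) (p := q) (by simp) (d - m)
  rw [Finset.compl_empty, Finset.card_univ, Fintype.card_fin] at h
  rw [← h, ← Finset.card_map (addRightEmbedding (Finsupp.single l m))]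
  refine Finset.card_le_card fun D' hD' => ?_
  obtain ⟨D, hD, rfl⟩ := Finset.mem_map.1 hD'
  rw [mem_boundedIdx] at hD
  rw [addRightEmbedding_apply, Finset.mem_sdiff, mem_boundedIdx, mem_boundedIdx, map_add,
    Finsupp.degree_single, hD.1, not_and]
  refine ⟨⟨by omega, by simp⟩, fun _ hcon => ?_⟩
  have := hcon l hl
  rw [Finsupp.add_apply, Finsupp.single_eq_same] at this
  omega

theorem card_boundedIdx_sdiff_add (d : ℕ) :
    (boundedIdx J p d \ boundedIdx I p d).card + (boundedIdx (J ∪ I) p d).card =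
      (boundedIdx J p d).card := by
  classical
  rw [← Finset.card_sdiff_add_card_inter (boundedIdx J p d) (boundedIdx I p d)]
  congr 2
  ext D
  rw [Finset.mem_inter, mem_boundedIdx, mem_boundedIdx, mem_boundedIdx, Finset.forall_mem_union]
  tauto

end Counting

theorem not_isUnimodal {h : ℕ → ℕ} {x y z j : ℕ} (hxy : x < y) (hyz : y < z) (hz : z ≤ j)
    (h1 : h y < h x) (h2 : h y < h z) : ¬ IsUnimodal h j := by
  rintro ⟨i, hi, hmono, hanti⟩
  rcases le_total y i with hyi | hyi
  · exact h1.not_ge (hmono ⟨Nat.zero_le _, by omega⟩ ⟨Nat.zero_le _, hyi⟩ hxy.le)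
  · exact h2.not_ge (hanti ⟨hyi, by omega⟩ ⟨by omega, hz⟩ hyz.le)

/-! ### Numerical drops and the six families. -/

section Drops

variable {k : Type*} [Field k] [CharZero k]

/-- With two free variables the increment is a count with one free variable, hence the constant `N`:
this is the linear growth of the part coming from `ℰ`. -/
theorem card_boundedIdx_succ_eq {r : ℕ} {I : Finset (Fin r)} {p : Fin r → ℕ} {l l' : Fin r}
    (hI : I = (Finset.univ.erase l').erase l) (hne : l ≠ l') (hpl : p l = 0) {N d : ℕ}
    (hprod : ∏ i ∈ I, (p i + 1) = N) (hsum : ∑ i ∈ I, p i ≤ d + 1) :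
    (boundedIdx I p (d + 1)).card = (boundedIdx I p d).card + N := by
  have hl : l ∉ I := by rw [hI]; exact Finset.notMem_erase _ _
  have hins : insert l I = Finset.univ.erase l' := by
    rw [hI]
    exact Finset.insert_erase (Finset.mem_erase.2 ⟨hne, Finset.mem_univ _⟩)
  rw [card_boundedIdx_succ hl hpl, card_boundedIdx_eq hins, Finset.prod_insert hl, hpl, hprod,
    zero_add, one_mul]
  rwa [Finset.sum_insert hl, hpl, zero_add]

/-- Here `e = j - iF`. As `I` and `J` are disjoint, one function `p` carries both systems of bounds.
`h1` and `h2` say that the decrease of `u · m_Q` exceeds `N` at the first step and is below `N` at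
the second. -/
theorem generallyNonUnimodal_singleDrop {r j s u iF : ℕ} {P Q : List ℕ} {I J : Finset (Fin r)}
    {p : Fin r → ℕ} {l l' l'' : Fin r} {i e N : ℕ}
    (hP : ∀ d ≤ j, constrainedIdx r P d = boundedIdx I p d)
    (hQ : constrainedIdx r Q j = boundedIdx J p j)
    (hI : I = (Finset.univ.erase l').erase l) (hne : l ≠ l') (hl'' : l'' ∉ J)
    (hIJ : Disjoint I J) (hp : ∀ i ∈ I, 1 ≤ p i) (hpl : p l = 0)
    (hj : j = i + (e + 2)) (hiF : iF = i + 2)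
    (hprod : ∏ i ∈ I, (p i + 1) = N) (hsum : ∑ i ∈ I, p i ≤ i + 1)
    (hs : (FamilyData.mk r j P Q s u iF).Sufficient)
    (hu : u * (boundedIdx J p (e + 2)).card ≤ (boundedIdx J p i \ boundedIdx I p i).card)
    (h1 : N + u * (boundedIdx J p (e + 1)).card < u * (boundedIdx J p (e + 2)).card)
    (h2 : u * (boundedIdx J p (e + 1)).card < N + u * (boundedIdx J p e).card) :
    (FamilyData.mk r j P Q s u iF).GenerallyNonUnimodal k fun h => HasSingleDrop h i := by
  have e0 : j - i = e + 2 := by omega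
  have e1 : j - (i + 1) = e + 1 := by omega
  have e2 : j - (i + 2) = e := by omega
  have hstep : ∀ d, i ≤ d → (boundedIdx I p (d + 1)).card = (boundedIdx I p d).card + N :=
    fun d hd => card_boundedIdx_succ_eq hI hne hpl hprod (by omega)
  refine generallyNonUnimodal_of hP hQ (l := l)
    (by rw [hI]; exact Finset.notMem_erase _ _) hl'' hIJ hp (i := i) (by omega) (by omega) (by omega) hs (by rw [e0]; exact hu) fun h hle hi hf => ?_
  have g1 := hle (i + 1) (by omega)
  rw [hiF] at hf
  rw [e0] at hi
  rw [e1, hstep i le_rfl] at g1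
  rw [e2, hstep (i + 1) (by omega), hstep i le_rfl] at hf
  have d1 : h (i + 1) < h i := by omega
  have d2 : h (i + 1) < h (i + 2) := by omega
  exact ⟨not_isUnimodal (Nat.lt_succ_self i) (Nat.lt_succ_self _) (by omega) d1 d2, d1, d2⟩

/-- With three free variables, `m_Q(j-d)` falls by `N + 1`, `N`, `N - 1` in the three steps after `i
= j - N`, against a growth by `N`. The bound thus moves by `-1`, `0`, `+1`, and since it is attained
at both ends, the two middle values lie strictly below. -/
theorem generallyNonUnimodal_doubleDrop {r j s u iF : ℕ} {P Q : List ℕ} {I J : Finset (Fin r)}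
    {p : Fin r → ℕ} {l l' l'' : Fin r} {i N : ℕ}
    (hP : ∀ d ≤ j, constrainedIdx r P d = boundedIdx I p d)
    (hQ : constrainedIdx r Q j = boundedIdx J p j)
    (hI : I = (Finset.univ.erase l').erase l) (hne : l ≠ l') (hl'' : l'' ∉ J)
    (hIJ : Disjoint I J) (hp : ∀ i ∈ I, 1 ≤ p i) (hpl : p l = 0)
    (hu : u = 1) (hj : j = i + N) (hiF : iF = i + 3) (hN : 3 ≤ N)
    (hprod : ∏ i ∈ I, (p i + 1) = N) (hsum : ∑ i ∈ I, p i ≤ i + 1)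
    (hJ : ∀ i ∈ J, p i = 0) (hJc : (Jᶜ).card = 3)
    (hs : (FamilyData.mk r j P Q s u iF).Sufficient)
    (hcount : Nat.multichoose 3 N ≤ (boundedIdx J p i \ boundedIdx I p i).card) :
    (FamilyData.mk r j P Q s u iF).GenerallyNonUnimodal k fun h => HasDoubleDrop h i := by
  obtain ⟨n, rfl⟩ : ∃ n, N = n + 3 := ⟨N - 3, by omega⟩
  have hQc : ∀ d, (boundedIdx J p d).card = Nat.multichoose 3 d := fun d => by
    rw [card_boundedIdx_zero_left hJ, hJc]
  have hm := multichoose_three_succ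
  have e0 : j - i = n + 3 := by omega
  have e1 : j - (i + 1) = n + 2 := by omega
  have e2 : j - (i + 2) = n + 1 := by omega
  have e3 : j - (i + 3) = n := by omega
  have hstep : ∀ d, i ≤ d → (boundedIdx I p (d + 1)).card = (boundedIdx I p d).card + (n + 3) :=
    fun d hd => card_boundedIdx_succ_eq hI hne hpl hprod (by omega)
  refine generallyNonUnimodal_of hP hQ (l := l)
    (by rw [hI]; exact Finset.notMem_erase _ _) hl'' hIJ hp (i := i) (by omega) (by omega) (by omega) hs
    (by rw [e0, hu, one_mul, hQc]; exact hcount) fun h hle hi hf => ?_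
  have g1 := hle (i + 1) (by omega)
  have g2 := hle (i + 2) (by omega)
  rw [hiF, e3, hu, hQc, hstep (i + 2) (by omega), hstep (i + 1) (by omega), hstep i le_rfl] at hf
  rw [e0, hu, hQc, hm (n + 2), hm (n + 1), hm n] at hi
  rw [e1, hu, hQc, hstep i le_rfl, hm (n + 1), hm n] at g1
  rw [e2, hu, hQc, hstep (i + 1) (by omega), hstep i le_rfl, hm n] at g2
  have d1 : h (i + 1) < h i := by omega
  have d2 : h (i + 2) < h i := by omega
  have d3 : h (i + 1) < h (i + 3) := by omega
  have d4 : h (i + 2) < h (i + 3) := by omega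
  exact ⟨not_isUnimodal (Nat.lt_succ_self i) (by omega : i + 1 < i + 3) (by omega) d1 d3,
    max_lt d1 d2, max_lt d3 d4⟩

theorem famF1_generallyNonUnimodal {a i s : ℕ} (ha : 4 ≤ a) (hi : 2 * a ≤ i)
    (hs : (famF1 a i s).Sufficient) :
    (famF1 a i s).GenerallyNonUnimodal k fun h => HasDoubleDrop h i := by
  refine generallyNonUnimodal_doubleDrop (r := 3) (I := {0}) (J := ∅) (p := ![a - 1, 0, 0])
    (l := 1) (l' := 2) (l'' := 0) (N := a)
    (fun d hd => constrainedIdx_eq_boundedIdx fun x y hy => ?_)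
    (constrainedIdx_eq_boundedIdx fun x y hy => ?_) (by decide) (by decide) (by decide)
    (by decide) ?_ rfl rfl rfl rfl (by omega) ?_ ?_ (by simp) rfl hs ?_
  · fin_cases x <;> simp
  · fin_cases x <;> first | (simp; done) | simpa using hy
  · simp
    omega
  · simp
    omega
  · simp
    omega
  · refine le_trans (multichoose_mono 2 (by omega : a ≤ i - a))
      (multichoose_le_card_boundedIdx_sdiff (Finset.mem_singleton_self 0) ?_ ?_)
    · simp
      omega
    · omega

/-- With `a = 2e + 5` and `x = i - a`, the radicand is `8(e+3)(e+4) + 1` and `(2x+3)^2 = 4(x+1)(x+2)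
+ 1`, so the bound on `i` amounts to the required inequality of binomials. -/
theorem famF2_count {e i : ℕ}
    (hi : (2 * ((2 * (e + 2) + 1 : ℕ) : ℝ) - 3 + Real.sqrt (2 * ((2 * (e + 2) + 1 : ℕ) : ℝ) ^ 2 +
      8 * ((2 * (e + 2) + 1 : ℕ) : ℝ) + 7)) / 2 ≤ (i : ℝ)) :
    2 * (e + 2) + 1 ≤ i ∧ 2 * Nat.multichoose 3 (e + 2) ≤
      Nat.multichoose 3 (i - (2 * (e + 2) + 1)) := by
  have hsq := Real.sq_sqrt (by positivity :
    (0 : ℝ) ≤ 2 * ((2 * (e + 2) + 1 : ℕ) : ℝ) ^ 2 + 8 * ((2 * (e + 2) + 1 : ℕ) : ℝ) + 7)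
  have h3 : (3 : ℝ) ≤ Real.sqrt
      (2 * ((2 * (e + 2) + 1 : ℕ) : ℝ) ^ 2 + 8 * ((2 * (e + 2) + 1 : ℕ) : ℝ) + 7) := by
    refine Real.le_sqrt_of_sq_le ?_
    push_cast
    nlinarith [(Nat.cast_nonneg e : (0 : ℝ) ≤ e)]
  have hai : 2 * (e + 2) + 1 ≤ i := by
    have : ((2 * (e + 2) + 1 : ℕ) : ℝ) ≤ i := by linarith
    exact_mod_cast this
  refine ⟨hai, ?_⟩
  obtain ⟨x, rfl⟩ := Nat.exists_eq_add_of_le hai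
  have hx : 2 * ((e + 3) * (e + 4)) ≤ (x + 1) * (x + 2) := by
    have h4 : Real.sqrt
      (2 * ((2 * (e + 2) + 1 : ℕ) : ℝ) ^ 2 + 8 * ((2 * (e + 2) + 1 : ℕ) : ℝ) + 7) ≤ 2 * x + 3 := by
      push_cast at hi ⊢
      linarith
    have h5 := pow_le_pow_left₀ (Real.sqrt_nonneg _) h4 2
    rw [hsq] at h5
    push_cast at h5
    have h6 : (2 * ((e + 3) * (e + 4)) : ℝ) ≤ (x + 1) * (x + 2) := by nlinarith
    exact_mod_cast h6
  rw [Nat.add_sub_cancel_left]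
  have h8 := two_mul_multichoose_three x
  have h9 := two_mul_multichoose_three (e + 2)
  linarith

theorem famF2_generallyNonUnimodal {a i s : ℕ} (ha : 7 ≤ a) (hodd : Odd a)
    (hi : (2 * (a : ℝ) - 3 + Real.sqrt (2 * (a : ℝ) ^ 2 + 8 * a + 7)) / 2 ≤ (i : ℝ))
    (hs : (famF2 a i s).Sufficient) :
    (famF2 a i s).GenerallyNonUnimodal k fun h => HasSingleDrop h i := by
  obtain ⟨m, rfl⟩ := hodd
  obtain ⟨e, rfl⟩ : ∃ e, m = e + 2 := ⟨m - 2, by omega⟩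
  obtain ⟨hai, hcount⟩ := famF2_count hi
  have hQc : ∀ (p : Fin 3 → ℕ) d, (boundedIdx ∅ p d).card = Nat.multichoose 3 d := fun p d =>
    card_boundedIdx_zero_left (by simp) d
  refine generallyNonUnimodal_singleDrop (r := 3) (I := {0}) (J := ∅)
    (p := ![2 * (e + 2) + 1 - 1, 0, 0]) (l := 1) (l' := 2) (l'' := 0) (e := e)
    (N := 2 * (e + 2) + 1)
    (fun d hd => constrainedIdx_eq_boundedIdx fun x y hy => ?_)
    (constrainedIdx_eq_boundedIdx fun x y hy => ?_) (by decide) (by decide) (by decide)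
    (by decide) ?_ rfl ?_ rfl ?_ ?_ hs ?_ ?_ ?_
  · fin_cases x <;> simp
  · fin_cases x <;> first | (simp; done) | simpa using hy
  · simp
    omega
  · omega
  · simp
  · simp
    omega
  · rw [hQc]
    exact hcount.trans (multichoose_le_card_boundedIdx_sdiff (Finset.mem_singleton_self 0)
      (by simp) hai)
  · rw [hQc, hQc, multichoose_three_succ (e + 1)]
    omega
  · rw [hQc, hQc, multichoose_three_succ e]
    omega

theorem famG1_generallyNonUnimodal {a b i s : ℕ} (ha : 2 ≤ a) (hab : a ≤ b) (hi : a * b + 1 ≤ i)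
    (hs : (famG1 a b i s).Sufficient) :
    (famG1 a b i s).GenerallyNonUnimodal k fun h => HasDoubleDrop h i := by
  have h4 : 4 ≤ a * b := Nat.mul_le_mul ha (ha.trans hab)
  have hsum : a + b ≤ a * b := by nlinarith
  have ea : a - 1 + 1 = a := by omega
  have eb : b - 1 + 1 = b := by omega
  have hJ : ∀ i ∈ ({3} : Finset (Fin 4)), ![a - 1, b - 1, 0, 0] i = 0 := by simp
  refine generallyNonUnimodal_doubleDrop (r := 4) (I := {0, 1}) (J := {3})
    (p := ![a - 1, b - 1, 0, 0]) (l := 2) (l' := 3) (l'' := 0) (N := a * b)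
    (fun d hd => constrainedIdx_eq_boundedIdx fun x y hy => ?_)
    (constrainedIdx_eq_boundedIdx fun x y hy => ?_) (by decide) (by decide) (by decide)
    (by decide) ?_ rfl rfl rfl rfl (by omega) ?_ ?_ hJ rfl hs ?_
  · fin_cases x <;> simp
  · fin_cases x <;> first | (simp; done) | simpa using hy
  · simp
    omega
  · simp [ea, eb]
  · simp
    omega
  · have h1 := card_boundedIdx_sdiff_add (I := {0, 1}) (J := {3}) (p := ![a - 1, b - 1, 0, 0]) i
    have h2 : (boundedIdx ({3} ∪ {0, 1}) ![a - 1, b - 1, 0, 0] i).card ≤ a * b :=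
      (card_boundedIdx_le (l := 2) (by decide) i).trans (by simp [ea, eb])
    rw [card_boundedIdx_zero_left hJ] at h1
    -- One degree beyond `ab` yields `ab + 2` additional monomials, enough to absorb the at most
    -- `ab` that satisfy both systems of bounds.
    have h3 : Nat.multichoose 3 (a * b + 1) ≤ Nat.multichoose (({3} : Finset (Fin 4))ᶜ).card i :=
      multichoose_mono 2 hi
    rw [multichoose_three_succ] at h3
    omega

/-- Consecutive squares differ by odd numbers, so the even `N = ab` fits strictly between two
successive decrements. -/
theorem card_boundedIdx_singleton_one (d : ℕ) :
    (boundedIdx {0} ![1, 0, 0, 0] d).card = (d + 1) ^ 2 := by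
  have key : ∀ d, (boundedIdx {3, 0} ![1, 0, 0, 0] d).card = 2 * d + 1 := by
    intro d
    induction d with
    | zero => rw [card_boundedIdx_degree_zero]
    | succ d ih =>
      rw [card_boundedIdx_succ_eq (l := 1) (l' := 2) (N := 2) (by decide) (by decide) rfl
        (by decide) (by simp), ih]
      ring
  induction d with
  | zero => rw [card_boundedIdx_degree_zero]; rfl
  | succ d ih =>
    rw [card_boundedIdx_succ (l := 3) (by decide) rfl, ih, key]
    ring

theorem famG2_generallyNonUnimodal {a b i s : ℕ} (ha : 2 ≤ a) (hab : a ≤ b) (heven : Even (a * b))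
    (hi : a * b / 2 + 2 ≤ i) (hs : (famG2 a b i s).Sufficient) :
    (famG2 a b i s).GenerallyNonUnimodal k fun h => HasSingleDrop h i := by
  have h4 : 4 ≤ a * b := Nat.mul_le_mul ha (ha.trans hab)
  have hsum : 2 * (a + b) ≤ a * b + 4 := by
    obtain ⟨x, rfl⟩ := Nat.exists_eq_add_of_le ha
    obtain ⟨y, rfl⟩ := Nat.exists_eq_add_of_le (ha.trans hab)
    nlinarith
  have ea : a - 1 + 1 = a := by omega
  have eb : b - 1 + 1 = b := by omega
  obtain ⟨n, hn⟩ := heven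
  obtain ⟨e, rfl⟩ : ∃ e, n = e + 2 := ⟨n - 2, by omega⟩
  have hQc : ∀ d, (boundedIdx {0} ![1, a - 1, b - 1, 0] d).card = (d + 1) ^ 2 := fun d => by
    rw [← card_boundedIdx_singleton_one, boundedIdx_congr]
    simp
  refine generallyNonUnimodal_singleDrop (r := 4) (I := {1, 2}) (J := {0})
    (p := ![1, a - 1, b - 1, 0]) (l := 3) (l' := 0) (l'' := 3) (e := e) (N := a * b)
    (fun d hd => constrainedIdx_eq_boundedIdx fun x y hy => ?_)
    (constrainedIdx_eq_boundedIdx fun x y hy => ?_) (by decide) (by decide) (by decide)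
    (by decide) ?_ rfl ?_ rfl ?_ ?_ hs ?_ ?_ ?_
  · have hy' : y ≤ i + a * b / 2 := hy.trans hd
    fin_cases x <;> simp [hy']
  · fin_cases x <;> simp
  · simp
    omega
  · omega
  · simp [ea, eb]
  · simp
    omega
  · have h1 := card_boundedIdx_sdiff_add (I := {1, 2}) (J := {0}) (p := ![1, a - 1, b - 1, 0]) i
    have h2 : (boundedIdx ({0} ∪ {1, 2}) ![1, a - 1, b - 1, 0] i).card ≤ 2 * (a * b) :=
      (card_boundedIdx_le (l := 3) (by decide) i).trans (by simp [ea, eb, mul_left_comm])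
    rw [hQc] at h1
    rw [hQc, one_mul]
    -- Here `ab = 2(e + 2)`, and `(e+5)^2 - (e+3)^2 = 4e + 16` exceeds the overlap bound `2ab = 4e +
    -- 8`.
    have h3 : (e + 5) ^ 2 ≤ (i + 1) ^ 2 := Nat.pow_le_pow_left (by omega) 2
    nlinarith
  · rw [hQc, hQc]
    nlinarith
  · rw [hQc, hQc]
    nlinarith

theorem sum_range_sum_range_two_mul_sub (a b : ℕ) (z : ℤ) :
    ∑ x ∈ Finset.range a, ∑ y ∈ Finset.range b, 2 * (z - x - y) = a * b * (2 * z - a - b + 2) := by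
  have h : ∀ (w : ℤ) (b : ℕ), ∑ y ∈ Finset.range b, 2 * (w - y) = b * (2 * w - b + 1) := by
    intro w b
    induction b with
    | zero => simp
    | succ b ih =>
      rw [Finset.sum_range_succ, ih]
      push_cast
      ring
  simp only [h]
  induction a with
  | zero => simp
  | succ a ih =>
    rw [Finset.sum_range_succ, ih]
    push_cast
    ring

/-- For fixed exponents `x < a`, `y < b` of the bounded variables there are at most `d + 1 - (x +
y)` choices for the others; `hd` keeps this subtraction from being truncated. -/
theorem two_mul_card_boundedIdx_pair_le {a b d : ℕ} (ha : 1 ≤ a) (hb : 1 ≤ b)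
    (hd : a + b ≤ d + 3) :
    2 * ((boundedIdx {0, 1} ![a - 1, b - 1, 0, 0] d).card : ℤ) ≤
      a * b * (2 * d - a - b + 4) := by
  have h1 : (boundedIdx {0, 1} ![a - 1, b - 1, 0, 0] d).card ≤
      ∑ x ∈ Finset.range a, ∑ y ∈ Finset.range b, (d + 1 - (x + y)) := by
    rw [← Finset.sum_product' _ _ fun x y => d + 1 - (x + y),
      Finset.card_eq_sum_card_fiberwise (f := fun D => (D 0, D 1))
        (t := Finset.range a ×ˢ Finset.range b)]
    · refine Finset.sum_le_sum fun z _ => ?_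
      rw [← Finset.card_range (d + 1 - (z.1 + z.2))]
      refine Finset.card_le_card_of_injOn (fun D => D 2) (fun D hD => ?_) fun D hD D' hD' h => ?_
      · rw [Finset.mem_coe, Finset.mem_filter, mem_boundedIdx, Finsupp.degree_eq_sum,
          Fin.sum_univ_four] at hD
        obtain ⟨⟨h1, -⟩, rfl⟩ := hD
        rw [Finset.mem_coe, Finset.mem_range]
        dsimp only
        omega
      · rw [Finset.mem_coe, Finset.mem_filter, mem_boundedIdx, Finsupp.degree_eq_sum,
          Fin.sum_univ_four] at hD hD'
        obtain ⟨⟨h1, -⟩, rfl⟩ := hD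
        obtain ⟨⟨h2, -⟩, h3⟩ := hD'
        rw [Prod.mk.injEq] at h3
        have h4 : D 2 = D' 2 := h
        ext x
        fin_cases x
        · exact h3.1.symm
        · exact h3.2.symm
        · exact h4
        · change D 3 = D' 3
          omega
    · intro D hD
      have h2 := (mem_boundedIdx.1 (Finset.mem_coe.1 hD)).2
      have h3 : D 0 ≤ a - 1 := h2 0 (by simp)
      have h4 : D 1 ≤ b - 1 := h2 1 (by simp)
      rw [Finset.mem_coe, Finset.mem_product, Finset.mem_range, Finset.mem_range]
      dsimp only
      omega
  have h2 := sum_range_sum_range_two_mul_sub a b (d + 1)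
  have h3 : (2 * (∑ x ∈ Finset.range a, ∑ y ∈ Finset.range b, (d + 1 - (x + y)) : ℕ) : ℤ) =
      ∑ x ∈ Finset.range a, ∑ y ∈ Finset.range b, 2 * ((d + 1 : ℤ) - x - y) := by
    rw [Nat.cast_sum, Finset.mul_sum]
    refine Finset.sum_congr rfl fun x hx => ?_
    rw [Nat.cast_sum, Finset.mul_sum]
    refine Finset.sum_congr rfl fun y hy => ?_
    rw [Finset.mem_range] at hx hy
    omega
  have h4 : ((boundedIdx {0, 1} ![a - 1, b - 1, 0, 0] d).card : ℤ) ≤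
      (∑ x ∈ Finset.range a, ∑ y ∈ Finset.range b, (d + 1 - (x + y)) : ℕ) := Nat.cast_le.2 h1
  linarith

theorem famG3_generallyNonUnimodal {a b m i s : ℕ} (ha : 2 ≤ a) (hab : a ≤ b)
    (hchoose : ∀ N : ℕ, a * b ≠ N.choose 2)
    (hm : IsGreatest {m : ℕ | (m + 1).choose 2 < a * b} m) (hi : a + b - 3 ≤ i)
    (hcount : (a : ℝ) * b * (2 * i - a - b + 4) / 2 + ((m + 3).choose 3 : ℝ) ≤
      ((i + 3).choose 3 : ℝ)) (hs : (famG3 a b m i s).Sufficient) :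
    (famG3 a b m i s).GenerallyNonUnimodal k fun h => HasSingleDrop h i := by
  have h4 : 4 ≤ a * b := Nat.mul_le_mul ha (ha.trans hab)
  have ea : a - 1 + 1 = a := by omega
  have eb : b - 1 + 1 = b := by omega
  have hm2 : 2 ≤ m := hm.2 (by
    change Nat.choose 3 2 < a * b
    have : Nat.choose 3 2 = 3 := rfl
    omega)
  obtain ⟨e, rfl⟩ : ∃ e, m = e + 2 := ⟨m - 2, by omega⟩
  have hlt : (e + 3).choose 2 < a * b := hm.1
  -- Maximality of `m = e + 2` gives only `≤`; that `ab` is not a binomial coefficient `N.choose 2`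
  -- makes it strict, so `ab` lies strictly between consecutive decrements.
  have hgt : a * b < (e + 4).choose 2 := by
    refine lt_of_le_of_ne ?_ (hchoose _)
    by_contra hcon
    have : e + 3 ≤ e + 2 := hm.2 (not_le.1 hcon)
    omega
  have hQc : ∀ (p : Fin 4 → ℕ) d, (boundedIdx ∅ p d).card = (d + 3).choose 3 := fun p d => by
    rw [card_boundedIdx_zero_left (by simp), Finset.compl_empty, Finset.card_univ,
      Fintype.card_fin, Nat.multichoose_eq, show 4 + d - 1 = d + 3 by omega, Nat.choose_symm_add]
  refine generallyNonUnimodal_singleDrop (r := 4) (I := {0, 1}) (J := ∅)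
    (p := ![a - 1, b - 1, 0, 0]) (l := 2) (l' := 3) (l'' := 0) (e := e) (N := a * b)
    (fun d hd => constrainedIdx_eq_boundedIdx fun x y hy => ?_)
    (constrainedIdx_eq_boundedIdx fun x y hy => ?_) (by decide) (by decide) (by decide)
    (by decide) ?_ rfl rfl rfl ?_ ?_ hs ?_ ?_ ?_
  · fin_cases x <;> simp
  · fin_cases x <;> first | (simp; done) | simpa using hy
  · simp
    omega
  · simp [ea, eb]
  · simp
    omega
  · have h1 := card_boundedIdx_sdiff_add (I := {0, 1}) (J := ∅) (p := ![a - 1, b - 1, 0, 0]) i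
    rw [hQc, Finset.empty_union] at h1
    have h2 := two_mul_card_boundedIdx_pair_le (a := a) (b := b) (d := i)
      (by omega) (by omega) (by omega)
    have h3 : (2 * ((boundedIdx {0, 1} ![a - 1, b - 1, 0, 0] i).card : ℝ)) ≤
      a * b * (2 * i - a - b + 4) := by exact_mod_cast h2
    rw [hQc, one_mul]
    have h5 : (((e + 2 + 3).choose 3 + (boundedIdx {0, 1} ![a - 1, b - 1, 0, 0] i).card : ℕ) : ℝ) ≤
        ((i + 3).choose 3 : ℝ) := by
      push_cast
      linarith
    have h6 := Nat.cast_le.1 h5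
    omega
  · rw [hQc, hQc, one_mul, one_mul, Nat.choose_succ_succ' (e + 2 + 2) 2]
    exact Nat.add_lt_add_right hgt _
  · rw [hQc, hQc, one_mul, one_mul, Nat.choose_succ_succ' (e + 1 + 2) 2]
    exact Nat.add_lt_add_right hlt _

theorem famH1_generallyNonUnimodal {a b c i s : ℕ} (ha : 2 ≤ a) (hab : a ≤ b) (hbc : b ≤ c)
    (hi : a * b * c ≤ i) (hs : (famH1 a b c i s).Sufficient) :
    (famH1 a b c i s).GenerallyNonUnimodal k fun h => HasDoubleDrop h i := by
  have h4 : 4 ≤ a * b := Nat.mul_le_mul ha (ha.trans hab)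
  have h8 : a + b ≤ a * b := by nlinarith
  have hsum : a + b + c ≤ a * b * c := by nlinarith
  have ea : a - 1 + 1 = a := by omega
  have eb : b - 1 + 1 = b := by omega
  have ec : c - 1 + 1 = c := by omega
  have hJ : ∀ i ∈ ({3, 4} : Finset (Fin 5)), ![a - 1, b - 1, c - 1, 0, 0] i = 0 := by simp
  refine generallyNonUnimodal_doubleDrop (r := 5) (I := {0, 1, 2}) (J := {3, 4})
    (p := ![a - 1, b - 1, c - 1, 0, 0]) (l := 3) (l' := 4) (l'' := 0) (N := a * b * c)
    (fun d hd => constrainedIdx_eq_boundedIdx fun x y hy => ?_)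
    (constrainedIdx_eq_boundedIdx fun x y hy => ?_) (by decide) (by decide) (by decide)
    (by decide) ?_ rfl rfl rfl rfl (by omega) ?_ ?_ hJ rfl hs ?_
  · fin_cases x <;> simp
  · fin_cases x <;> first | (simp; done) | simpa using hy
  · simp
    omega
  · simp [ea, eb, ec, mul_assoc]
  · simp
    omega
  · have h1 := card_boundedIdx_sdiff_add (I := {0, 1, 2}) (J := {3, 4})
      (p := ![a - 1, b - 1, c - 1, 0, 0]) i
    -- All five variables are bounded here, with total bound `a + b + c - 3 < i`, so no monomial of
    -- degree `i` satisfies both systems.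
    have h2 : (boundedIdx ({3, 4} ∪ {0, 1, 2}) ![a - 1, b - 1, c - 1, 0, 0] i).card = 0 := by
      rw [Finset.card_eq_zero, Finset.eq_empty_iff_forall_notMem]
      intro D hD
      obtain ⟨h5, h6⟩ := mem_boundedIdx.1 hD
      rw [Finsupp.degree_eq_sum, Fin.sum_univ_five] at h5
      have h7 : ∑ x, D x ≤ ∑ x, ![a - 1, b - 1, c - 1, 0, 0] x :=
        Finset.sum_le_sum fun x _ => h6 x (by revert x; decide)
      simp [Fin.sum_univ_five] at h7
      omega
    rw [card_boundedIdx_zero_left hJ] at h1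
    have h3 : Nat.multichoose 3 (a * b * c) ≤ Nat.multichoose (({3, 4} : Finset (Fin 5))ᶜ).card i :=
      multichoose_mono 2 hi
    omega

end Drops

end LevelAlg

theorem mainTheorem1 (k : Type*) [Field k] [IsAlgClosed k] [CharZero k] :
    (∀ a i s : ℕ, 4 ≤ a → 2 * a ≤ i →
      (LevelAlg.famF1 a i s).Sufficient →
      (LevelAlg.famF1 a i s).GenerallyNonUnimodal k
        (fun h => LevelAlg.HasDoubleDrop h i)) ∧
    (∀ a i s : ℕ, 7 ≤ a → Odd a →
      (2 * (a : ℝ) - 3 + Real.sqrt (2 * (a : ℝ) ^ 2 + 8 * a + 7)) / 2 ≤ (i : ℝ) →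
      (LevelAlg.famF2 a i s).Sufficient →
      (LevelAlg.famF2 a i s).GenerallyNonUnimodal k
        (fun h => LevelAlg.HasSingleDrop h i)) ∧
    (∀ a b i s : ℕ, 2 ≤ a → a ≤ b → a * b + 1 ≤ i →
      (LevelAlg.famG1 a b i s).Sufficient →
      (LevelAlg.famG1 a b i s).GenerallyNonUnimodal k
        (fun h => LevelAlg.HasDoubleDrop h i)) ∧
    (∀ a b i s : ℕ, 2 ≤ a → a ≤ b → Even (a * b) → a * b / 2 + 2 ≤ i →
      (LevelAlg.famG2 a b i s).Sufficient →
      (LevelAlg.famG2 a b i s).GenerallyNonUnimodal k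
        (fun h => LevelAlg.HasSingleDrop h i)) ∧
    (∀ a b m i s : ℕ, 2 ≤ a → a ≤ b → (∀ N : ℕ, a * b ≠ N.choose 2) →
      IsGreatest {m : ℕ | (m + 1).choose 2 < a * b} m →
      a + b - 3 ≤ i →
      (a : ℝ) * b * (2 * i - a - b + 4) / 2 + ((m + 3).choose 3 : ℝ) ≤ ((i + 3).choose 3 : ℝ) →
      (LevelAlg.famG3 a b m i s).Sufficient →
      (LevelAlg.famG3 a b m i s).GenerallyNonUnimodal k
        (fun h => LevelAlg.HasSingleDrop h i)) ∧
    (∀ a b c i s : ℕ, 2 ≤ a → a ≤ b → b ≤ c → a * b * c ≤ i →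
      (LevelAlg.famH1 a b c i s).Sufficient →
      (LevelAlg.famH1 a b c i s).GenerallyNonUnimodal k
        (fun h => LevelAlg.HasDoubleDrop h i)) := by
  refine ⟨?_, ?_, ?_, ?_, ?_, ?_⟩
  · exact fun a i s ha hi hs => LevelAlg.famF1_generallyNonUnimodal ha hi hs
  · exact fun a i s ha hodd hi hs => LevelAlg.famF2_generallyNonUnimodal ha hodd hi hs
  · exact fun a b i s ha hab hi hs => LevelAlg.famG1_generallyNonUnimodal ha hab hi hs
  · exact fun a b i s ha hab heven hi hs =>
      LevelAlg.famG2_generallyNonUnimodal ha hab heven hi hs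
  · exact fun a b m i s ha hab hchoose hm hi hcount hs =>
      LevelAlg.famG3_generallyNonUnimodal ha hab hchoose hm hi hcount hs
  · exact fun a b c i s ha hab hbc hi hs => LevelAlg.famH1_generallyNonUnimodal ha hab hbc hi hs
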